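/- Let $S\subset\mathbb R^3$ be the unit sphere, $T_sS=s^\perp\subset\mathbb R^3$, and let $\pi:Q\to S$ be the smooth real rank two vector bundle whose fibre $Q_s$ over $s\in S$ is the space of all symmetric linear maps $q:T_sS\to T_sS$ with $\operatorname{trace} q=0$. Every nonzero $q\in Q_s$ is invertible; outside the zero section $0_Q$ let $\omega$ be the $\mathbb R^3$-valued one-form $\omega_q=q^{-1}\circ T_q\pi:T_qQ\to T_sS\subset\mathbb R^3$. Let $v_0=e_1+\mathrm i e_2\in\mathbb C^3$, let $B$ be the subgroup of all $b\in \mathrm{SO}(3,\mathbb C)$ such that $b(\mathbb C v_0)=\mathbb C v_0$, and define $\rho:B\to\mathbb C\setminus\{0\}$ by $b\,v_0=\rho(b)\,v_0$. Let $\mathrm{SO}(3,\mathbb C)\times_B\mathbb C$ be the complex analytic manifold of orbits $[g,z]$ in $\mathrm{SO}(3,\mathbb C)\times\mathbb C$ of the action $b\cdot(g,z)=(g\,b^{-1},\rho(b)^{-2}z)$ of $B$. Provide $Q$ with the complex structure for which the bijection $Q\to \mathrm{SO}(3,\mathbb C)\times_B\mathbb C$, $q\mapsto[g,a+\mathrm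 i b]$, is a complex analytic diffeomorphism, where $q\in Q_s$, $g\in\mathrm{SO}(3)$ is any rotation with $g\,e_3=s$, and $\begin{pmatrix}a&b\\ b&-a\end{pmatrix}$ is the matrix of $g^{-1}qg\in Q_{e_3}$ with respect to $e_1,e_2$. Provide $S$ with the complex structure of the quadric $N=\{\mathbb C z\mid z\in\mathbb C^3\setminus\{0\},\ \langle z,z\rangle=0\}$ in the complex projective plane, by means of the diffeomorphism $N\to S$, $\mathbb C(x+\mathrm i y)\mapsto\langle x,x\rangle^{-1}\,x\times y$ $(x,y\in\mathbb R^3)$. (1) Let $C$ be a real two-dimensional smooth (immersed) submanifold of $Q$. Then $\omega|_C$ is closed, that is, $\mathrm d(\omega|_C)=0$ on $C\setminus 0_Q$, if and only if $C$ is a complex analytic curve in $Q$. (2) Let $M$ be a smoothly immersed minimal surface in $\mathbb R^3$ with Gauss map (continuous unit normal) $n:M\to S$, provided with a complex structure, compatible with its smooth structure, for which $n$ is complex analytic. For $x\in M$ let $n'(x):T_{n(x)}S\to T_{n(x)}S$ be the tangent map $T_xn:T_xM\to T_{n(x)}S$ of $n$, where $T_xM$ is identified with $T_{n(x)}S=n(x)^\perp$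 by means of the tangent map of the immersion; minimality means that $\operatorname{trace}n'(x)=0$ for every $x\in M$. Then $n'(x)$ is symmetric, hence $n'(x)\in Q_{n(x)}$, for every $x\in M$, and the map $n':M\to Q$ is complex analytic. -/

import Mathlib

open scoped Manifold ContDiff Matrix InnerProductSpace

noncomputable section

namespace SecondOrderContact

/-! ### The bundle `Q` over the unit sphere and the one-form `ω = q⁻¹ ds` -/

/-- Euclidean three-space. -/
abbrev E3 := EuclideanSpace ℝ (Fin 3)

/-- The unit sphere `S` in `ℝ³`. -/
abbrev S2 := Metric.sphere (0 : E3) 1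

/-- The tangent plane `T_s S`, as the linear subspace of `ℝ³` orthogonal to `s`. -/
abbrev TS (s : S2) : Submodule ℝ E3 := (ℝ ∙ (s : E3))ᗮ

/-- The total space of the bundle `Q` over `S`: the fibre over `s` is the space of all traceless
symmetric linear maps `T_s S → T_s S`. -/
structure Q where
  base : S2
  op : TS base →ₗ[ℝ] TS base
  symm : op.IsSymmetric
  traceless : LinearMap.trace ℝ (TS base) op = 0

/-- The ambient vector space in which `Q` is embedded as a smooth submanifold. -/
abbrev Amb := E3 × (E3 →L[ℝ] E3)

/-- The embedding of `Q` in the vector space `ℝ³ × Lin(ℝ³, ℝ³)`, where `q` is extended by zero on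
the normal line `ℝ s`. The smooth structure of `Q` is the one of this submanifold: a map into `Q` is
smooth iff its composition with `embed` is, and tangent vectors of `Q` are elements of `Amb`. -/
def embed (q : Q) : Amb :=
  ((q.base : E3),
    (TS q.base).subtypeL ∘L LinearMap.toContinuousLinearMap q.op ∘L
      (TS q.base).orthogonalProjectionOnto)

/-- The one-form `ω = q⁻¹ ds` at a point `q` of `Q` outside the zero section: the tangent map of
the projection `π : Q → S`, which sends `(δs, δq)` to `δs ∈ T_s S`, followed by
`q⁻¹ : T_s S → T_s S ⊆ ℝ³`. (The orthogonal projection only serves to view `δs`, which lies in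
`T_s S` if `(δs, δq)` is tangent to `Q`, as an element of the subtype. `Ring.inverse` is the inverse
in the endomorphism ring; every nonzero element of a fibre is invertible.) -/
def omega (q : Q) : Amb →L[ℝ] E3 :=
  (TS q.base).subtypeL ∘L LinearMap.toContinuousLinearMap (Ring.inverse q.op) ∘L
    (TS q.base).orthogonalProjectionOnto ∘L ContinuousLinearMap.fst ℝ E3 (E3 →L[ℝ] E3)

/-! ### The complex manifold `SO(3,ℂ) ×_B ℂ` -/

/-- The complex rotation group `{g | g gᵀ = 1, det g = 1}`. -/
abbrev SO3C := Matrix.specialOrthogonalGroup (Fin 3) ℂ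

/-- The isotropic vector `e₁ + i e₂` of `ℂ³`. -/
def v0 : Fin 3 → ℂ := ![1, Complex.I, 0]

lemma v0_ne : v0 ≠ 0 := fun h => by simpa [v0] using congrFun h 0

lemma mul_transpose_SO (g : SO3C) : g.1 * g.1ᵀ = 1 :=
  (Matrix.mem_orthogonalGroup_iff (Fin 3) ℂ).1 (Matrix.mem_specialOrthogonalGroup_iff.1 g.2).1

lemma transpose_mul_SO (g : SO3C) : g.1ᵀ * g.1 = 1 :=
  (Matrix.mem_orthogonalGroup_iff' (Fin 3) ℂ).1 (Matrix.mem_specialOrthogonalGroup_iff.1 g.2).1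

lemma map_span_v0 (A : Matrix (Fin 3) (Fin 3) ℂ) :
    (ℂ ∙ v0).map (Matrix.toLin' A) = ℂ ∙ (A *ᵥ v0) := by
  rw [Submodule.map_span, Set.image_singleton, Matrix.toLin'_apply]

/-- The subgroup `B` of all `b ∈ SO(3,ℂ)` which leave the complex line `ℂ (e₁ + i e₂)`
invariant. -/
def B : Subgroup SO3C where
  carrier := {b | (ℂ ∙ v0).map (Matrix.toLin' b.1) = ℂ ∙ v0}
  one_mem' := by simp
  mul_mem' := by
    intro a b ha hb
    simp only [Set.mem_ofPred_eq] at ha hb ⊢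
    rw [Submonoid.coe_mul, Matrix.toLin'_mul, Submodule.map_comp, hb, ha]
  inv_mem' := by
    intro a ha
    simp only [Set.mem_ofPred_eq] at ha ⊢
    conv_lhs => rw [← ha]
    rw [← Submodule.map_comp, ← Matrix.toLin'_mul, ← Submonoid.coe_mul, inv_mul_cancel]
    simp

/-- The character `ρ` of `B` for which `b (e₁ + i e₂) = ρ(b) (e₁ + i e₂)`
(see `mulVec_v0`). -/
def rho (b : B) : ℂ := (b.1.1 *ᵥ v0) 0

lemma mulVec_v0 (b : B) : b.1.1 *ᵥ v0 = rho b • v0 := by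
  have h : (ℂ ∙ v0).map (Matrix.toLin' b.1.1) = ℂ ∙ v0 := b.2
  rw [map_span_v0] at h
  have h1 : b.1.1 *ᵥ v0 ∈ ℂ ∙ v0 := h ▸ Submodule.mem_span_singleton_self _
  obtain ⟨t, ht⟩ := Submodule.mem_span_singleton.1 h1
  have : rho b = t := by rw [rho, ← ht]; simp [v0]
  rw [this, ht]

lemma rho_mul (a b : B) : rho (a * b) = rho a * rho b := by
  have h : (a * b).1.1 *ᵥ v0 = (rho b * rho a) • v0 := by
    have : (a * b).1.1 = a.1.1 * b.1.1 := rfl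
    rw [this, ← Matrix.mulVec_mulVec, mulVec_v0, Matrix.mulVec_smul, mulVec_v0, smul_smul]
  rw [rho, h]
  simp [v0, mul_comm]

lemma rho_one : rho 1 = 1 := by simp [rho, v0]

lemma rho_ne (b : B) : rho b ≠ 0 := by
  intro h
  have := rho_mul b b⁻¹
  rw [mul_inv_cancel, rho_one, h, zero_mul] at this
  exact one_ne_zero this

/-- The action of `b ∈ B` on `SO(3,ℂ) × ℂ`: it sends `(g, z)` to `(g b⁻¹, ρ(b)⁻² z)`. -/
def act (b : B) (p : SO3C × ℂ) : SO3C × ℂ := (p.1 * b.1⁻¹, (rho b ^ 2)⁻¹ * p.2)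

lemma act_one (p : SO3C × ℂ) : act 1 p = p := by simp [act, rho_one]

lemma act_mul (a b : B) (p : SO3C × ℂ) : act (a * b) p = act a (act b p) := by
  ext1
  · simp [act, mul_assoc]
  · simp only [act, rho_mul, mul_pow, mul_inv]
    ring

/-- Two points are equivalent iff they are in the same `B`-orbit. -/
def orbitSetoid : Setoid (SO3C × ℂ) where
  r p p' := ∃ b : B, p' = act b p
  iseqv :=
    { refl := fun p => ⟨1, (act_one p).symm⟩
      symm := by
        rintro p _ ⟨b, rfl⟩
        exact ⟨b⁻¹, by rw [← act_mul, inv_mul_cancel, act_one]⟩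
      trans := by
        rintro p _ _ ⟨b, rfl⟩ ⟨a, rfl⟩
        exact ⟨a * b, by rw [act_mul]⟩ }

/-- The associated bundle `SO(3,ℂ) ×_B ℂ`, the space of `B`-orbits in `SO(3,ℂ) × ℂ`. -/
def Assoc := Quotient orbitSetoid

/-- The quotient topology. -/
instance : TopologicalSpace Assoc := inferInstanceAs (TopologicalSpace (Quotient orbitSetoid))

/-- The orbit `[g, z]` of `(g, z)`. -/
def Assoc.mk (g : SO3C) (z : ℂ) : Assoc := Quotient.mk orbitSetoid (g, z)

lemma mk_eq_of {g g' : SO3C} {z z' t : ℂ} (hg : g'.1 *ᵥ v0 = t • g.1 *ᵥ v0)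
    (hz : z' = t ^ 2 * z) : Assoc.mk g z = Assoc.mk g' z' := by
  have ht : t ≠ 0 := by
    rintro rfl
    have h := congrArg (fun x => (g'.1)ᵀ *ᵥ x) hg
    simp only [Matrix.mulVec_mulVec, transpose_mul_SO, Matrix.one_mulVec, zero_smul,
      Matrix.mulVec_zero] at h
    exact v0_ne h
  have hb : (g⁻¹ * g').1 *ᵥ v0 = t • v0 := by
    rw [Submonoid.coe_mul, ← Matrix.mulVec_mulVec, hg, Matrix.mulVec_smul, Matrix.mulVec_mulVec,
      ← Submonoid.coe_mul, inv_mul_cancel]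
    simp
  have hB : g⁻¹ * g' ∈ B := by
    change (ℂ ∙ v0).map (Matrix.toLin' (g⁻¹ * g').1) = ℂ ∙ v0
    rw [map_span_v0, hb]
    exact Submodule.span_singleton_smul_eq (IsUnit.mk0 t ht) v0
  have hr : rho ⟨_, hB⟩ = t := by
    change ((g⁻¹ * g').1 *ᵥ v0) 0 = t
    rw [hb]; simp [v0]
  apply Quotient.sound
  refine ⟨(⟨_, hB⟩ : B)⁻¹, ?_⟩
  have hr2 : rho (⟨_, hB⟩ : B)⁻¹ = t⁻¹ := by
    have := rho_mul (⟨_, hB⟩ : B) (⟨_, hB⟩ : B)⁻¹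
    rw [mul_inv_cancel, rho_one, hr] at this
    field_simp
    rw [mul_comm]; exact this.symm
  ext1
  · simp [act]
  · simp only [act, hr2, hz]
    field_simp

/-! Holomorphic charts. If `w = g (e₁ + i e₂)` and `κ² = -1`, `d = w₁ + κ w₂`, then
`[g, z] ↦ (w₃ / d, z / d²)` is a bijection from the open set where `d ≠ 0` onto `ℂ × ℂ`; the
two charts with `κ = -i` and `κ = i` cover `SO(3,ℂ) ×_B ℂ`. -/

/-- The denominator `d = w₁ + κ w₂` where `w = g (e₁ + i e₂)`. -/
def den (κ : ℂ) (g : SO3C) : ℂ := (g.1 *ᵥ v0) 0 + κ * (g.1 *ᵥ v0) 1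

/-- The chart, on representatives. -/
def preChart (κ : ℂ) (p : SO3C × ℂ) : ℂ × ℂ :=
  ((p.1.1 *ᵥ v0) 2 / den κ p.1, p.2 / den κ p.1 ^ 2)

lemma act_mulVec (b : B) (p : SO3C × ℂ) :
    (act b p).1.1 *ᵥ v0 = (rho b)⁻¹ • p.1.1 *ᵥ v0 := by
  have h : (b⁻¹ : B).1.1 *ᵥ v0 = (rho b)⁻¹ • v0 := by
    rw [mulVec_v0]
    congr 1
    have := rho_mul b⁻¹ b
    rw [inv_mul_cancel, rho_one] at this
    exact eq_inv_of_mul_eq_one_left this.symm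
  have h2 : (act b p).1.1 = p.1.1 * (b⁻¹ : B).1.1 := rfl
  rw [h2, ← Matrix.mulVec_mulVec, h, Matrix.mulVec_smul]

lemma den_act (κ : ℂ) (b : B) (p : SO3C × ℂ) :
    den κ (act b p).1 = (rho b)⁻¹ * den κ p.1 := by
  simp only [den, act_mulVec, Pi.smul_apply, smul_eq_mul]
  ring

lemma preChart_act (κ : ℂ) (b : B) (p : SO3C × ℂ) : preChart κ (act b p) = preChart κ p := by
  have hb := rho_ne b
  ext1
  · simp only [preChart, den_act, act_mulVec, Pi.smul_apply, smul_eq_mul]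
    rw [mul_div_mul_left _ _ (inv_ne_zero hb)]
  · simp only [preChart, den_act]
    simp only [act, mul_pow, inv_pow]
    rw [mul_div_mul_left _ _ (inv_ne_zero (pow_ne_zero 2 hb))]

/-- The chart as a map on `SO(3,ℂ) ×_B ℂ`. -/
def chartFun (κ : ℂ) : Assoc → ℂ × ℂ :=
  Quotient.lift (preChart κ) (by rintro p _ ⟨b, rfl⟩; exact (preChart_act κ b p).symm)

/-- The domain of the chart. -/
def chartDom (κ : ℂ) : Set Assoc :=
  {x | Quotient.lift (fun p : SO3C × ℂ => den κ p.1 ≠ 0)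
    (by
      rintro p _ ⟨b, rfl⟩
      have := rho_ne b
      simp [den_act, this]) x}

/-- A holomorphic family of elements of `SO(3,ℂ)` which gives the inverse of the chart. -/
def sectMat (κ u : ℂ) : Matrix (Fin 3) (Fin 3) ℂ :=
  !![(5 - u ^ 2) / 4, -Complex.I * (-3 - u ^ 2) / 4, -Complex.I * κ * u;
     κ * (3 - u ^ 2) / 4, Complex.I * κ * (5 + u ^ 2) / 4, Complex.I * u;
     u / 2, -Complex.I * u / 2, Complex.I * κ]

lemma sectMat_mem {κ : ℂ} (hκ : κ ^ 2 = -1) (u : ℂ) :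
    sectMat κ u ∈ Matrix.specialOrthogonalGroup (Fin 3) ℂ := by
  have hI : Complex.I ^ 2 = -1 := Complex.I_sq
  rw [Matrix.mem_specialOrthogonalGroup_iff, Matrix.mem_orthogonalGroup_iff]
  constructor
  · ext i j
    fin_cases i <;> fin_cases j <;>
      simp [sectMat, Matrix.mul_apply, Fin.sum_univ_three] <;>
      grind
  · rw [sectMat, Matrix.det_fin_three]
    simp
    grind

/-- The family `sectMat`, as elements of `SO(3,ℂ)`. -/
def sect {κ : ℂ} (hκ : κ ^ 2 = -1) (u : ℂ) : SO3C := ⟨sectMat κ u, sectMat_mem hκ u⟩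

lemma sect_v0 {κ : ℂ} (hκ : κ ^ 2 = -1) (u : ℂ) :
    (sect hκ u).1 *ᵥ v0 = ![(1 - u ^ 2) / 2, -κ * (1 + u ^ 2) / 2, u] := by
  have hI : Complex.I ^ 2 = -1 := Complex.I_sq
  ext i
  fin_cases i <;> simp [sect, sectMat, v0, Matrix.mulVec, dotProduct, Fin.sum_univ_three] <;> grind

lemma den_sect {κ : ℂ} (hκ : κ ^ 2 = -1) (u : ℂ) : den κ (sect hκ u) = 1 := by
  rw [den, sect_v0]
  simp
  grind

lemma isotropic (g : SO3C) :
    (g.1 *ᵥ v0) 0 ^ 2 + (g.1 *ᵥ v0) 1 ^ 2 + (g.1 *ᵥ v0) 2 ^ 2 = 0 := by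
  have h : (g.1 *ᵥ v0) ⬝ᵥ (g.1 *ᵥ v0) = 0 := by
    rw [Matrix.dotProduct_mulVec, ← Matrix.mulVec_transpose, Matrix.mulVec_mulVec,
      transpose_mul_SO, Matrix.one_mulVec]
    simp [v0, dotProduct, Fin.sum_univ_three]
  simpa [dotProduct, Fin.sum_univ_three, sq] using h

lemma mulVec_v0_eq {κ : ℂ} (hκ : κ ^ 2 = -1) (g : SO3C) (hd : den κ g ≠ 0) :
    g.1 *ᵥ v0 = den κ g • (sect hκ ((g.1 *ᵥ v0) 2 / den κ g)).1 *ᵥ v0 := by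
  have h := isotropic g
  rw [sect_v0]
  have hdef : den κ g = (g.1 *ᵥ v0) 0 + κ * (g.1 *ᵥ v0) 1 := rfl
  generalize g.1 *ᵥ v0 = w at *
  generalize den κ g = d at *
  ext i
  fin_cases i
  · simp
    field_simp
    grind
  · simp
    field_simp
    grind
  · simp
    field_simp

lemma sect_surj {κ : ℂ} (hκ : κ ^ 2 = -1) (g : SO3C) (z : ℂ) (hd : den κ g ≠ 0) :
    Assoc.mk (sect hκ ((g.1 *ᵥ v0) 2 / den κ g)) (z / den κ g ^ 2) = Assoc.mk g z :=
  mk_eq_of (mulVec_v0_eq hκ g hd) (by field_simp)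

lemma continuous_mulVec : Continuous fun g : SO3C => g.1 *ᵥ v0 :=
  Continuous.matrix_mulVec continuous_subtype_val continuous_const

lemma continuous_den (κ : ℂ) : Continuous (den κ) := by
  have h := continuous_mulVec
  exact ((continuous_apply 0).comp h).add (continuous_const.mul ((continuous_apply 1).comp h))

lemma continuous_sect {κ : ℂ} (hκ : κ ^ 2 = -1) : Continuous (sect hκ) := by
  refine Continuous.subtype_mk ?_ _
  refine continuous_pi fun i => continuous_pi fun j => ?_
  fin_cases i <;> fin_cases j <;> simp [sectMat] <;> fun_prop

lemma continuous_mk : Continuous fun p : SO3C × ℂ => Assoc.mk p.1 p.2 :=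
  continuous_quotient_mk'

lemma isQuotientMap_mk : Topology.IsQuotientMap fun p : SO3C × ℂ => Assoc.mk p.1 p.2 :=
  isQuotientMap_quotient_mk'

lemma isOpen_chartDom (κ : ℂ) : IsOpen (chartDom κ) := by
  rw [← isQuotientMap_mk.isOpen_preimage]
  exact isOpen_ne_fun ((continuous_den κ).comp continuous_fst) continuous_const

/-- The holomorphic chart of `SO(3,ℂ) ×_B ℂ` belonging to `κ`. -/
def assocChart {κ : ℂ} (hκ : κ ^ 2 = -1) : OpenPartialHomeomorph Assoc (ℂ × ℂ) where
  toFun := chartFun κ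
  invFun := fun y => Assoc.mk (sect hκ y.1) y.2
  source := chartDom κ
  target := Set.univ
  map_source' := fun _ _ => trivial
  map_target' := by
    intro y _
    change den κ (sect hκ y.1) ≠ 0
    rw [den_sect]
    exact one_ne_zero
  left_inv' := by
    intro x hx
    induction x using Quotient.inductionOn with
    | h p => exact sect_surj hκ p.1 p.2 hx
  right_inv' := by
    intro y _
    change preChart κ (sect hκ y.1, y.2) = y
    simp [preChart, den_sect, sect_v0]
  open_source := isOpen_chartDom κ
  open_target := isOpen_univ
  continuousOn_toFun := by
    rw [isQuotientMap_mk.continuousOn_isOpen_iff (isOpen_chartDom κ)]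
    have h := continuous_mulVec.comp (continuous_fst (X := SO3C) (Y := ℂ))
    have hd := (continuous_den κ).comp (continuous_fst (X := SO3C) (Y := ℂ))
    change ContinuousOn (preChart κ) _
    refine ContinuousOn.prodMk ?_ ?_
    · exact (((continuous_apply 2).comp h).continuousOn).div hd.continuousOn fun p hp => hp
    · exact continuous_snd.continuousOn.div (hd.pow 2).continuousOn fun p hp => pow_ne_zero 2 hp
  continuousOn_invFun :=
    (continuous_mk.comp (((continuous_sect hκ).comp continuous_fst).prodMk
      continuous_snd)).continuousOn

lemma negI_sq : (-Complex.I) ^ 2 = -1 := by simp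

lemma chart_cover (x : Assoc) (hx : x ∉ chartDom (-Complex.I)) : x ∈ chartDom Complex.I := by
  induction x using Quotient.inductionOn with
  | h p =>
    have h1 : den (-Complex.I) p.1 = 0 := not_not.1 hx
    change den Complex.I p.1 ≠ 0
    intro h2
    have h3 := isotropic p.1
    have h4 : p.1.1 *ᵥ v0 ≠ 0 := by
      intro h
      have h5 := congrArg (fun y => (p.1.1)ᵀ *ᵥ y) h
      simp only [Matrix.mulVec_mulVec, transpose_mul_SO, Matrix.one_mulVec,
        Matrix.mulVec_zero] at h5
      exact v0_ne h5
    simp only [den] at h1 h2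
    have hI := Complex.I_ne_zero
    have ha : (p.1.1 *ᵥ v0) 0 = 0 := by linear_combination (h1 + h2) / 2
    have hb : (p.1.1 *ᵥ v0) 1 = 0 := by
      rw [ha, zero_add] at h2
      exact (mul_eq_zero.1 h2).resolve_left hI
    have hc : (p.1.1 *ᵥ v0) 2 = 0 := by
      rw [ha, hb] at h3
      simpa using h3
    apply h4
    ext i
    fin_cases i
    · exact ha
    · exact hb
    · exact hc

open scoped Classical in
/-- The atlas of `SO(3,ℂ) ×_B ℂ` consisting of the two charts. -/
instance : ChartedSpace (ℂ × ℂ) Assoc where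
  atlas := {assocChart negI_sq, assocChart Complex.I_sq}
  chartAt x := if x ∈ chartDom (-Complex.I) then assocChart negI_sq else assocChart Complex.I_sq
  mem_chart_source x := by
    by_cases h : x ∈ chartDom (-Complex.I)
    · rw [if_pos h]; exact h
    · rw [if_neg h]; exact chart_cover x h
  chart_mem_atlas x := by
    by_cases h : x ∈ chartDom (-Complex.I)
    · rw [if_pos h]; exact Set.mem_insert _ _
    · rw [if_neg h]; exact Set.mem_insert_of_mem _ rfl

lemma contDiffOn_transition {κ κ' : ℂ} (hκ : κ ^ 2 = -1) (hκ' : κ' ^ 2 = -1) :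
    ContDiffOn ℂ ω (𝓘(ℂ, ℂ × ℂ) ∘ (assocChart hκ).symm ≫ₕ assocChart hκ' ∘ 𝓘(ℂ, ℂ × ℂ).symm)
      (𝓘(ℂ, ℂ × ℂ).symm ⁻¹' ((assocChart hκ).symm ≫ₕ assocChart hκ').source ∩
        Set.range 𝓘(ℂ, ℂ × ℂ)) := by
  have hden : ∀ y : ℂ × ℂ, den κ' (sect hκ y.1) =
      (1 - y.1 ^ 2) / 2 + κ' * (-κ * (1 + y.1 ^ 2) / 2) := by
    intro y
    rw [den, sect_v0]
    simp
  have key : ContDiffOn ℂ ω (fun y : ℂ × ℂ => preChart κ' (sect hκ y.1, y.2))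
      {y | den κ' (sect hκ y.1) ≠ 0} := by
    simp only [preChart, hden, sect_v0]
    refine ContDiffOn.prodMk ?_ ?_
    · refine ContDiffOn.div ?_ ?_ fun y hy => by exact hy
      · simp only [Matrix.cons_val]
        fun_prop
      · fun_prop
    · refine ContDiffOn.div ?_ ?_ fun y hy => pow_ne_zero 2 hy
      · fun_prop
      · fun_prop
  refine key.mono ?_
  rintro y ⟨hy, -⟩
  exact hy.2

/-- `SO(3,ℂ) ×_B ℂ` is a complex analytic manifold of complex dimension two. -/
instance : IsManifold 𝓘(ℂ, ℂ × ℂ) ω Assoc := by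
  refine isManifold_of_contDiffOn _ _ _ ?_
  rintro e e' (rfl | rfl) (rfl | rfl) <;> exact contDiffOn_transition _ _

/-! ### The identification of `Q` with `SO(3,ℂ) ×_B ℂ` -/

/-- The vector product in `ℝ³`. -/
def cross (x y : E3) : E3 := WithLp.toLp 2 (crossProduct x.ofLp y.ofLp)

/-- The real rotation with columns `v`, `s × v`, `s`, where `v` is a unit vector in `T_s S`. It maps
`e₃` to `s`. -/
def frame (s : S2) (v : E3) : Matrix (Fin 3) (Fin 3) ℝ :=
  Matrix.of fun i j => ![v i, cross s v i, (s : E3) i] j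

lemma cross_apply0 (x y : E3) : cross x y 0 = x 1 * y 2 - x 2 * y 1 := by
  simp [cross, cross_apply]

lemma cross_apply1 (x y : E3) : cross x y 1 = x 2 * y 0 - x 0 * y 2 := by
  simp [cross, cross_apply]

lemma cross_apply2 (x y : E3) : cross x y 2 = x 0 * y 1 - x 1 * y 0 := by
  simp [cross, cross_apply]

lemma sq_sum (x : E3) (hx : ‖x‖ = 1) : x 0 ^ 2 + x 1 ^ 2 + x 2 ^ 2 = 1 := by
  have h := EuclideanSpace.norm_sq_eq x
  rw [hx] at h
  simpa [Fin.sum_univ_three] using h.symm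

lemma inner_sum (x y : E3) : ⟪x, y⟫_ℝ = x 0 * y 0 + x 1 * y 1 + x 2 * y 2 := by
  simp only [PiLp.inner_apply, Fin.sum_univ_three]
  simp [mul_comm]

lemma mem_TS {s : S2} {v : E3} : v ∈ TS s ↔ ⟪(s : E3), v⟫_ℝ = 0 :=
  Submodule.mem_orthogonal_singleton_iff_inner_right

lemma norm_base (s : S2) : ‖(s : E3)‖ = 1 := by simp

lemma cross_mem (s : S2) (v : E3) : cross s v ∈ TS s := by
  rw [mem_TS, inner_sum, cross_apply0, cross_apply1, cross_apply2]
  ring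

lemma frame_orth {s : S2} {v : E3} (hv : v ∈ TS s) (hn : ‖v‖ = 1) :
    (frame s v)ᵀ * frame s v = 1 := by
  have h1 := sq_sum s (norm_base s)
  have h2 := sq_sum v hn
  rw [mem_TS, inner_sum] at hv
  ext i j
  fin_cases i <;> fin_cases j <;>
    simp [frame, Matrix.mul_apply, Fin.sum_univ_three, cross_apply0, cross_apply1,
      cross_apply2] <;> beta_reduce at * <;> grind

lemma frame_mem {s : S2} {v : E3} (hv : v ∈ TS s) (hn : ‖v‖ = 1) :
    (frame s v).map ((↑) : ℝ → ℂ) ∈ Matrix.specialOrthogonalGroup (Fin 3) ℂ := by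
  have ht := frame_orth hv hn
  have h1 := sq_sum s (norm_base s)
  have h2 := sq_sum v hn
  rw [mem_TS, inner_sum] at hv
  have hd : (frame s v).det = 1 := by
    rw [Matrix.det_fin_three]
    simp [frame, cross_apply0, cross_apply1, cross_apply2]
    beta_reduce at *
    grind
  rw [Matrix.mem_specialOrthogonalGroup_iff, Matrix.mem_orthogonalGroup_iff']
  constructor
  · have h := congrArg (fun A : Matrix (Fin 3) (Fin 3) ℝ => A.map (Complex.ofRealHom)) ht
    simp only [Matrix.map_mul] at h
    rw [Matrix.map_one _ (map_zero _) (map_one _)] at h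
    exact h
  · have h := Complex.ofRealHom.map_det (frame s v)
    rw [hd, map_one] at h
    exact h.symm

/-- The rotation `frame s v` as an element of `SO(3) ⊆ SO(3,ℂ)`. -/
def frameSO (s : S2) (v : {v : TS s // ‖(v : E3)‖ = 1}) : SO3C :=
  ⟨(frame s v.1).map ((↑) : ℝ → ℂ), frame_mem v.1.2 v.2⟩

lemma exists_unit (s : S2) : ∃ v : TS s, ‖(v : E3)‖ = 1 := by
  have h0 : (s : E3) ≠ 0 := by
    intro h
    have := norm_base s
    rw [h, norm_zero] at this
    exact zero_ne_one this
  have h : Module.finrank ℝ (TS s) = 2 := by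
    have : Fact (Module.finrank ℝ E3 = 2 + 1) := ⟨by simp⟩
    exact Submodule.finrank_orthogonal_span_singleton h0
  have : Nontrivial (TS s) := Module.nontrivial_of_finrank_pos (R := ℝ) (by omega)
  obtain ⟨v, hv⟩ := exists_norm_eq (TS s) zero_le_one
  exact ⟨v, hv⟩

/-- The complex number `a + i b`, where `q v = a v + b (s × v)`. If `g` is the rotation
`frame s v`, this corresponds to the matrix `(a, b; b, -a)` of `g⁻¹ q g ∈ Q_{e₃}`. -/
def fibreCoord (q : Q) (v : {v : TS q.base // ‖(v : E3)‖ = 1}) : ℂ :=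
  (⟪(v.1 : E3), (q.op v.1 : E3)⟫_ℝ : ℂ) +
    Complex.I * (⟪cross q.base v.1, (q.op v.1 : E3)⟫_ℝ : ℂ)

/-- The identification of `Q ≅ SO(3) ×_{SO(2)} Q_{e₃}` with `SO(3,ℂ) ×_B ℂ`. If `g` is a rotation
with `g e₃ = s` and if `g⁻¹ q g ∈ Q_{e₃}` has the matrix `(a, b; b, -a)`, then `q ∈ Q_s` is
identified with the orbit `[g, a + i b]`. This does not depend on the choice of `g`,
see `toAssoc_eq`. -/
def toAssoc (q : Q) : Assoc :=
  Assoc.mk (frameSO q.base ⟨_, (exists_unit q.base).choose_spec⟩)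
    (fibreCoord q ⟨_, (exists_unit q.base).choose_spec⟩)

lemma tangent_decomp {s : S2} {v w : E3} (hv : v ∈ TS s) (hn : ‖v‖ = 1) (hw : w ∈ TS s) :
    w = ⟪v, w⟫_ℝ • v + ⟪cross s v, w⟫_ℝ • cross s v := by
  have h := mul_eq_one_comm.1 (frame_orth hv hn)
  have hij := fun i j => congrFun (congrFun h i) j
  simp only [frame, Matrix.mul_apply, Fin.sum_univ_three, Matrix.transpose_apply,
    Matrix.of_apply, Matrix.cons_val, Matrix.one_apply] at hij
  have h00 := hij 0 0
  have h01 := hij 0 1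
  have h02 := hij 0 2
  have h11 := hij 1 1
  have h12 := hij 1 2
  have h22 := hij 2 2
  simp at h00 h01 h02 h11 h12 h22
  rw [mem_TS, inner_sum] at hw
  ext i
  fin_cases i
  · simp only [inner_sum, PiLp.add_apply, PiLp.smul_apply, smul_eq_mul, Fin.zero_eta]
    beta_reduce at *
    grind
  · simp only [inner_sum, PiLp.add_apply, PiLp.smul_apply, smul_eq_mul, Fin.mk_one]
    beta_reduce at *
    grind
  · simp only [inner_sum, PiLp.add_apply, PiLp.smul_apply, smul_eq_mul, Fin.reduceFinMk]
    beta_reduce at *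
    grind

lemma norm_cross {s : S2} {v : E3} (hv : v ∈ TS s) (hn : ‖v‖ = 1) : ‖cross s v‖ = 1 := by
  have h := congrFun (congrFun (frame_orth hv hn) 1) 1
  simp [frame, Matrix.mul_apply, Fin.sum_univ_three] at h
  rw [EuclideanSpace.norm_eq, Fin.sum_univ_three]
  simp [sq, h]

lemma inner_cross (s : S2) (v : E3) : ⟪v, cross s v⟫_ℝ = 0 := by
  rw [inner_sum, cross_apply0, cross_apply1, cross_apply2]
  ring

/-- In terms of the basis `v`, `s × v` of `T_s S`, the trace of `q` is the sum of the two diagonal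
coefficients. -/
lemma diag_neg (q : Q) (v : {v : TS q.base // ‖(v : E3)‖ = 1}) :
    ⟪cross q.base v.1, (q.op ⟨_, cross_mem q.base v.1⟩ : E3)⟫_ℝ =
      -⟪(v.1 : E3), (q.op v.1 : E3)⟫_ℝ := by
  have hon : Orthonormal ℝ ![v.1, ⟨_, cross_mem q.base v.1⟩] := by
    have hn : ‖v.1‖ = 1 := v.2
    have hn2 : ‖(⟨_, cross_mem q.base v.1⟩ : TS q.base)‖ = 1 := norm_cross v.1.2 v.2
    have hi : ⟪v.1, (⟨_, cross_mem q.base v.1⟩ : TS q.base)⟫_ℝ = 0 := inner_cross _ _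
    have hi2 : ⟪(⟨_, cross_mem q.base v.1⟩ : TS q.base), v.1⟫_ℝ = 0 := by
      rw [real_inner_comm]; exact hi
    constructor
    · intro i
      fin_cases i
      · exact hn
      · exact hn2
    · intro i j hij
      fin_cases i <;> fin_cases j
      · exact absurd rfl hij
      · exact hi
      · exact hi2
      · exact absurd rfl hij
  have hsp : ⊤ ≤ Submodule.span ℝ (Set.range ![v.1, ⟨_, cross_mem q.base v.1⟩]) := by
    intro w _
    have h := tangent_decomp v.1.2 v.2 w.2
    have h2 : w = ⟪(v.1 : E3), w⟫_ℝ • v.1 +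
        ⟪cross q.base v.1, w⟫_ℝ • (⟨_, cross_mem q.base v.1⟩ : TS q.base) := Subtype.ext h
    rw [h2]
    refine Submodule.add_mem _ (Submodule.smul_mem _ _ (Submodule.subset_span ⟨0, rfl⟩))
      (Submodule.smul_mem _ _ (Submodule.subset_span ⟨1, rfl⟩))
  have ht := q.traceless
  rw [LinearMap.trace_eq_sum_inner q.op (OrthonormalBasis.mk hon hsp), Fin.sum_univ_two] at ht
  simp only [OrthonormalBasis.coe_mk, Matrix.cons_val_zero, Matrix.cons_val_one,
    Submodule.coe_inner] at ht
  linarith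

lemma frameSO_v0 (s : S2) (v : {v : TS s // ‖(v : E3)‖ = 1}) (i : Fin 3) :
    ((frameSO s v).1 *ᵥ v0) i = ((v.1 : E3) i : ℂ) + Complex.I * (cross s v.1 i : ℂ) := by
  simp [frameSO, frame, v0, Matrix.mulVec, dotProduct, Fin.sum_univ_three]
  ring

/-- The identification of `Q` with `SO(3,ℂ) ×_B ℂ` does not depend on the choice of the rotation
which maps `e₃` to `s`. -/
theorem toAssoc_eq (q : Q) (v : {v : TS q.base // ‖(v : E3)‖ = 1}) :
    toAssoc q = Assoc.mk (frameSO q.base v) (fibreCoord q v) := by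
  suffices H : ∀ v v' : {v : TS q.base // ‖(v : E3)‖ = 1},
      Assoc.mk (frameSO q.base v) (fibreCoord q v) =
        Assoc.mk (frameSO q.base v') (fibreCoord q v') from H _ _
  clear v
  intro v v'
  set w : TS q.base := ⟨_, cross_mem q.base v.1⟩ with hw
  obtain ⟨c, d, hcd⟩ : ∃ c d : ℝ, v'.1 = c • v.1 + d • w :=
    ⟨_, _, Subtype.ext (tangent_decomp v.1.2 v.2 v'.1.2)⟩
  have hcdE : (v'.1 : E3) = c • (v.1 : E3) + d • cross q.base v.1 := congrArg Subtype.val hcd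
  have hs := sq_sum q.base (norm_base q.base)
  have hv := sq_sum v.1 v.2
  have ho := v.1.2
  rw [mem_TS, inner_sum] at ho
  have hcross : cross q.base v'.1 = c • cross q.base v.1 - d • (v.1 : E3) := by
    rw [hcdE]
    ext i
    fin_cases i <;> simp [cross_apply0, cross_apply1, cross_apply2] <;> beta_reduce at * <;> grind
  have hdiag := diag_neg q v
  have hsym : ⟪(v.1 : E3), (q.op w : E3)⟫_ℝ = ⟪cross q.base v.1, (q.op v.1 : E3)⟫_ℝ := by
    have h := q.symm v.1 w
    rw [Submodule.coe_inner, Submodule.coe_inner] at h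
    rw [← h, real_inner_comm]
  refine mk_eq_of (t := (c : ℂ) - Complex.I * d) ?_ ?_
  · ext i
    have hI : Complex.I ^ 2 = -1 := Complex.I_sq
    rw [Pi.smul_apply, frameSO_v0, frameSO_v0, hcross, hcdE]
    simp
    grind
  · have hI : Complex.I ^ 2 = -1 := Complex.I_sq
    have hop : (q.op v'.1 : E3) = c • (q.op v.1 : E3) + d • (q.op w : E3) := by
      rw [hcd]; simp
    have ha : ⟪(v'.1 : E3), (q.op v'.1 : E3)⟫_ℝ =
        (c ^ 2 - d ^ 2) * ⟪(v.1 : E3), (q.op v.1 : E3)⟫_ℝ +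
          2 * c * d * ⟪cross q.base v.1, (q.op v.1 : E3)⟫_ℝ := by
      rw [hop, hcdE]
      simp only [inner_add_left, inner_add_right, inner_smul_left, inner_smul_right, hsym]
      rw [hdiag]
      simp
      ring
    have hb : ⟪cross q.base v'.1, (q.op v'.1 : E3)⟫_ℝ =
        (c ^ 2 - d ^ 2) * ⟪cross q.base v.1, (q.op v.1 : E3)⟫_ℝ -
          2 * c * d * ⟪(v.1 : E3), (q.op v.1 : E3)⟫_ℝ := by
      rw [hop, hcross]
      simp only [inner_sub_left, inner_add_right, inner_smul_left, inner_smul_right, hsym]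
      rw [hdiag]
      simp
      ring
    rw [fibreCoord, fibreCoord, ha, hb]
    push_cast
    grind

/-! ### Real surfaces in `Q`

Real two-dimensional manifolds are modelled on `ℂ`, viewed as a two-dimensional real vector space;
their smooth structure is the one with respect to `𝓘(ℝ, ℂ)`, and nothing else about `ℂ` is used. -/

section Surfaces

variable {C : Type*} [TopologicalSpace C] [ChartedSpace ℂ C]

/-- The map `c : C → Q` is a smooth immersion, i.e. it makes `C` an immersed two-dimensional smooth
submanifold of `Q`. -/
structure IsImmersedSurface (c : C → Q) : Prop where
  smooth : ContMDiff 𝓘(ℝ, ℂ) 𝓘(ℝ, Amb) ∞ (embed ∘ c)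
  immersive : ∀ p, Function.Injective (mfderiv 𝓘(ℝ, ℂ) 𝓘(ℝ, Amb) (embed ∘ c) p)

/-- The restriction `ω|_C = c^* ω`, expressed in the local coordinates given by a chart `e`
of `C`, as an `ℝ³`-valued one-form on (an open subset of) `ℂ ≅ ℝ²`. -/
def omegaInChart (c : C → Q) (e : OpenPartialHomeomorph C ℂ) (z : ℂ) : ℂ [⋀^Fin 1]→L[ℝ] E3 :=
  ContinuousAlternatingMap.ofSubsingleton ℝ ℂ E3 (0 : Fin 1)
    (omega (c (e.symm z)) ∘L fderiv ℝ (embed ∘ c ∘ e.symm) z)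

/-- The form `ω|_C` is closed: its exterior derivative vanishes in the coordinates of every
chart of `C`, at all points which are not mapped into the zero section of `Q`
(where `ω` has a pole and is not defined). -/
def OmegaClosedOn (c : C → Q) : Prop :=
  ∀ e ∈ atlas ℂ C, ∀ z ∈ e.target, (c (e.symm z)).op ≠ 0 → extDeriv (omegaInChart c e) z = 0

/-- The immersed surface `c : C → Q` is a complex analytic curve in `Q`: near every point of `C`
there is a complex coordinate `e` of `C`, compatible with the smooth structure of `C`, such that
the inverse of `e`, followed by `c`, is a holomorphic map to `Q ≅ SO(3,ℂ) ×_B ℂ`. -/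
def IsComplexCurve (c : C → Q) : Prop :=
  ∀ p : C, ∃ e ∈ IsManifold.maximalAtlas 𝓘(ℝ, ℂ) ∞ C, p ∈ e.source ∧
    MDifferentiableOn 𝓘(ℂ, ℂ) 𝓘(ℂ, ℂ × ℂ) (toAssoc ∘ c ∘ e.symm) e.target

end Surfaces

/-! ### Minimal surfaces -/

/-- The map `σ` which sends an isotropic vector `z = x + i y ≠ 0` in `ℂ³` to
`⟨x, x⟩⁻¹ x × y ∈ S`. It induces a bijection from the quadric `N = {ℂ z | ⟨z, z⟩ = 0}` in the
complex projective plane onto `S`. -/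
def sigma (z : Fin 3 → ℂ) : E3 :=
  let x : E3 := WithLp.toLp 2 fun i => (z i).re
  let y : E3 := WithLp.toLp 2 fun i => (z i).im
  (⟪x, x⟫_ℝ)⁻¹ • cross x y

section MinimalSurfaces

variable {M : Type*} [TopologicalSpace M] [ChartedSpace ℂ M]

/-- The map `n : M → S` on a complex one-dimensional manifold is complex analytic, where `S` has the
complex structure of the projective quadric `N ≅ S`: locally `n = σ ∘ w`, where `w` is a
holomorphic map to the isotropic vectors in `ℂ³ \ {0}`, i.e. where `ℂ w` is a holomorphic map
to `N`. -/
def IsHolomorphicToSphere (n : M → S2) : Prop :=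
  ∀ p : M, ∃ U : Set M, IsOpen U ∧ p ∈ U ∧ ∃ w : M → (Fin 3 → ℂ),
    MDifferentiableOn 𝓘(ℂ, ℂ) 𝓘(ℂ, Fin 3 → ℂ) w U ∧
      ∀ x ∈ U, w x ≠ 0 ∧ w x ⬝ᵥ w x = 0 ∧ (n x : E3) = sigma (w x)

/-- The map `n'` on `M` is holomorphic as a map to `Q ≅ SO(3,ℂ) ×_B ℂ`. -/
def IsHolomorphicToQ (f : M → Q) : Prop :=
  MDifferentiable 𝓘(ℂ, ℂ) 𝓘(ℂ, ℂ × ℂ) (toAssoc ∘ f)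

/-- `ε : M → ℝ³` is a smooth immersion of the surface `M` and `n : M → S` is the corresponding Gauss
map: a continuous choice of a unit vector which is orthogonal to the tangent plane. -/
structure IsOrientedImmersion (ε : M → E3) (n : M → S2) : Prop where
  smooth : ContMDiff 𝓘(ℝ, ℂ) 𝓘(ℝ, E3) ∞ ε
  immersive : ∀ x, Function.Injective (mfderiv 𝓘(ℝ, ℂ) 𝓘(ℝ, E3) ε x)
  continuous_normal : Continuous n
  normal : ∀ x (v : ℂ), ⟪(n x : E3), (mfderiv 𝓘(ℝ, ℂ) 𝓘(ℝ, E3) ε x v : E3)⟫_ℝ = 0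

/-- The derivative of the Gauss map at `x`, as a linear endomorphism `n'(x)` of `T_{n(x)} S`: the
inverse of the tangent map of the immersion `ε`, from `T_{n(x)} S = im (T_x ε)` to `T_x M`,
followed by the tangent map of `n`. (The left inverse of `T_x ε` is only applied to vectors in its
image, and the tangent map of `n` has values in `T_{n(x)} S`, so that the orthogonal
projection does nothing.) -/
def gaussDeriv (ε : M → E3) (n : M → S2) (x : M) : TS (n x) →ₗ[ℝ] TS (n x) :=
  let dε : ℂ →L[ℝ] E3 := mfderiv 𝓘(ℝ, ℂ) 𝓘(ℝ, E3) ε x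
  let dn : ℂ →L[ℝ] E3 := mfderiv 𝓘(ℝ, ℂ) 𝓘(ℝ, E3) (fun y => (n y : E3)) x
  (TS (n x)).orthogonalProjectionOnto.toLinearMap ∘ₗ dn.toLinearMap ∘ₗ
    dε.toLinearMap.leftInverse ∘ₗ (TS (n x)).subtype

/-- The immersed surface is minimal: the trace of `n'(x)` is zero for every `x`. -/
def IsMinimal (ε : M → E3) (n : M → S2) : Prop :=
  ∀ x, LinearMap.trace ℝ (TS (n x)) (gaussDeriv ε n x) = 0

end MinimalSurfaces

end SecondOrderContact

end

open SecondOrderContact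

noncomputable section

namespace SecondOrderContact

open scoped ComplexConjugate

/-! Identify `T_s S` with `ℂ` by `x ↦ ξ = x · w`, where `w = v + i (s × v)` for a unit tangent
vector `v`. A traceless symmetric map is then conjugate linear, `ξ ↦ z ξ̄`, with `z` the fibre
coordinate (`op_apply`, `dotC_op`). Its square is `|z|²`, so `q⁻¹ x = Re (z⁻¹ ξ w)`.

Rescaling `w` to the Weierstrass vector `w(u) = ((1 - u²)/2, -κ(1 + u²)/2, u)`, with `u` the
stereographic coordinate of `s`, replaces `z` by `ζ = z / d²`; the pair `(u, ζ)` is the chart of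
`SO(3,ℂ) ×_B ℂ` (`exists_den`). Differentiating `s · w(u) = 0` gives `ds · w(u) = -iκ du`, hence `ω
= Re (-iκ ζ⁻¹ w(u) du)` on any surface. The term with `du ∧ du` drops out and `dω = Re (iκ ζ⁻² w(u)
dζ ∧ du)`. Since `w(u)` is isotropic and nonzero, `a ↦ Re (a w(u))` is injective on `ℂ`
(`re_smul_eq_zero`). So `ω` is closed exactly when the complex two-form `dζ ∧ du` pulls back to zero
(`extDeriv_omega_eq_zero_iff`), a condition that extends over the zero section by continuity.

For an immersed surface, `dζ ∧ du = 0` makes `du` or `dζ` invertible at each point. That function is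
then a local coordinate in which the other one is holomorphic (`exists_holomorphic_coordinate`), so
the surface is a complex curve. Conversely, on a complex curve `du` and `dζ` are complex multiples
of one differential.

For a minimal surface, `n'` is symmetric because the second fundamental form is, and minimality puts
it in `Q`. The coordinate `u` of `n` is holomorphic by hypothesis. Conjugate linearity of `n'` makes
the immersion conformal where `u' ≠ 0`, so `dε = Re (g w(u) dz)`; since `dε` is closed, `g` is
holomorphic there (`differentiableAt_weierstrass`). Everywhere `ζ = -iκ u' / g` with `g` continuous
and nonzero, so isolated zeros of `u'` are removable singularities of `ζ`
(`differentiableAt_deriv_div`). -/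

/-! ### Isotropic vectors and the stereographic projection -/

/-- The complex bilinear pairing of a real vector with a complex vector. -/
def dotC (t : E3) (w : Fin 3 → ℂ) : ℂ := t 0 * w 0 + t 1 * w 1 + t 2 * w 2

/-- The equation `s × w = -i w`: the complex line `ℂ w` of the quadric corresponds to the
unit vector `s`. -/
structure IsNullOver (s : E3) (w : Fin 3 → ℂ) : Prop where
  eq0 : (s 1 : ℂ) * w 2 - s 2 * w 1 = -Complex.I * w 0
  eq1 : (s 2 : ℂ) * w 0 - s 0 * w 2 = -Complex.I * w 1
  eq2 : (s 0 : ℂ) * w 1 - s 1 * w 0 = -Complex.I * w 2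

/-- The Weierstrass parametrization of the isotropic vectors `w` with `w₁ + κ w₂ = 1`. -/
def nullVec (κ u : ℂ) : Fin 3 → ℂ := ![(1 - u ^ 2) / 2, -κ * (1 + u ^ 2) / 2, u]

/-- The denominator of the stereographic projection. -/
def stereoDen (κ : ℂ) (s : E3) : ℂ := 1 + Complex.I * κ * s 2

/-- The stereographic projection belonging to `κ`. -/
def stereo (κ : ℂ) (s : E3) : ℂ := -(Complex.I * κ * s 0 + Complex.I * s 1) / stereoDen κ s

lemma dotC_smul (t : E3) (a : ℂ) (w : Fin 3 → ℂ) : dotC t (a • w) = a * dotC t w := by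
  simp [dotC]; ring

namespace IsNullOver

variable {s : E3} {w : Fin 3 → ℂ}

lemma smul (h : IsNullOver s w) (a : ℂ) : IsNullOver s (a • w) := by
  obtain ⟨h0, h1, h2⟩ := h
  constructor <;> simp only [Pi.smul_apply, smul_eq_mul]
  · linear_combination a * h0
  · linear_combination a * h1
  · linear_combination a * h2

/-- Pair `s × w = -i w` with `s`; the triple product vanishes. Pairing with `w` instead gives
`isotropic`. -/
lemma dotC_eq_zero (h : IsNullOver s w) : dotC s w = 0 := by
  obtain ⟨h0, h1, h2⟩ := h
  have hI : Complex.I ^ 2 = -1 := Complex.I_sq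
  rw [dotC]
  linear_combination (-Complex.I) * (s 0 * h0 + s 1 * h1 + s 2 * h2) +
    (s 0 * w 0 + s 1 * w 1 + s 2 * w 2) * hI

lemma isotropic (h : IsNullOver s w) : w 0 ^ 2 + w 1 ^ 2 + w 2 ^ 2 = 0 := by
  obtain ⟨h0, h1, h2⟩ := h
  have hI : Complex.I ^ 2 = -1 := Complex.I_sq
  linear_combination (-Complex.I) * (w 0 * h0 + w 1 * h1 + w 2 * h2) +
    (w 0 ^ 2 + w 1 ^ 2 + w 2 ^ 2) * hI

/-- The relation between `w` and the stereographic projection with denominators cleared, so that it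
also holds at the pole. -/
lemma mul_stereo (h : IsNullOver s w) {κ : ℂ} (hκ : κ ^ 2 = -1) :
    -(Complex.I * κ * s 0 + Complex.I * s 1) * (w 0 + κ * w 1) = stereoDen κ s * w 2 := by
  have hd := h.dotC_eq_zero
  obtain ⟨h0, h1, h2⟩ := h
  have hI : Complex.I ^ 2 = -1 := Complex.I_sq
  rw [dotC] at hd
  rw [stereoDen]
  grind

/-- Both denominators vanish only over the pole `s₃ = -iκ`, which is `1` or `-1`. -/
lemma den_ne_zero_iff (h : IsNullOver s w) (hw : w ≠ 0) {κ : ℂ} (hκ : κ ^ 2 = -1)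
    (hs : ‖s‖ = 1) : w 0 + κ * w 1 ≠ 0 ↔ stereoDen κ s ≠ 0 := by
  have hi := h.isotropic
  obtain ⟨h0, -, -⟩ := h
  have hI : Complex.I ^ 2 = -1 := Complex.I_sq
  have hs1 := sq_sum s hs
  refine not_congr ⟨fun h => ?_, fun h => ?_⟩
  -- Isotropy factors as `(w₁ + κ w₂)(w₁ - κ w₂) = -w₃²` because `κ² = -1`.
  · have hw2 : w 2 = 0 := by
      have : w 2 ^ 2 = 0 := by linear_combination hi - (w 0 - κ * w 1) * h - w 1 ^ 2 * hκ
      simpa using this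
    have hw1 : w 1 ≠ 0 := by
      intro h1
      refine hw (funext fun i => ?_)
      fin_cases i
      · simpa [h1] using h
      · exact h1
      · exact hw2
    refine (mul_eq_zero.1 ?_).resolve_right hw1
    rw [stereoDen]
    linear_combination (-Complex.I * κ) * h0 - κ * h + Complex.I * κ * s 1 * hw2 +
      w 1 * hκ + κ * w 0 * hI
  · rw [stereoDen] at h
    have hs2 : (s 2 : ℂ) = -Complex.I * κ := by
      linear_combination (Complex.I * κ) * h - κ ^ 2 * s 2 * hI + s 2 * hκ
    have hs2' : s 2 ^ 2 = 1 := by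
      have : (s 2 : ℂ) ^ 2 = 1 := by rw [hs2]; linear_combination κ ^ 2 * hI - hκ
      exact Complex.ofReal_injective (by push_cast; exact this)
    have hs1' : s 1 = 0 := by
      beta_reduce at *
      nlinarith [sq_nonneg (s 0), sq_nonneg (s 1)]
    rw [hs1', hs2] at h0
    push_cast at h0
    linear_combination -Complex.I * h0 + (κ * w 1 + w 0) * hI

/-- With `d = w₁ + κ w₂` and `u = w₃ / d`, isotropy gives `w₁ - κ w₂ = -d u²`; solve for `w₁` and
`w₂`. -/
lemma eq_smul_nullVec (h : IsNullOver s w) {κ : ℂ} (hκ : κ ^ 2 = -1)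
    (hd : w 0 + κ * w 1 ≠ 0) :
    w = (w 0 + κ * w 1) • nullVec κ (w 2 / (w 0 + κ * w 1)) := by
  have h := h.isotropic
  obtain ⟨d, hdef⟩ : ∃ d, d = w 0 + κ * w 1 := ⟨_, rfl⟩
  rw [← hdef] at hd ⊢
  ext i
  fin_cases i
  · simp [nullVec]
    field_simp
    grind
  · simp [nullVec]
    field_simp
    grind
  · simp [nullVec]
    field_simp

lemma stereo_eq (h : IsNullOver s w) {κ : ℂ} (hκ : κ ^ 2 = -1)
    (hd : w 0 + κ * w 1 ≠ 0) (hs : stereoDen κ s ≠ 0) :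
    w 2 / (w 0 + κ * w 1) = stereo κ s := by
  rw [stereo, div_eq_div_iff hd hs]
  linear_combination -(h.mul_stereo hκ)

end IsNullOver

/-- This is `s × (s × v) = -v` for `v` tangent at `s`. -/
lemma isNullOver_frame (s : S2) (v : {v : TS s // ‖(v : E3)‖ = 1}) :
    IsNullOver s ((frameSO s v).1 *ᵥ v0) := by
  have hI : Complex.I ^ 2 = -1 := Complex.I_sq
  have hs := sq_sum s (norm_base s)
  have ho := v.1.2
  rw [mem_TS, inner_sum] at ho
  constructor <;> rw [frameSO_v0, frameSO_v0, frameSO_v0] <;>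
    apply Complex.ext <;> simp [cross_apply0, cross_apply1, cross_apply2] <;>
    beta_reduce at * <;> grind

lemma sigma_apply (w : Fin 3 → ℂ) (i : Fin 3) :
    sigma w i = ((w 0).re ^ 2 + (w 1).re ^ 2 + (w 2).re ^ 2)⁻¹ *
      cross (WithLp.toLp 2 fun i => (w i).re) (WithLp.toLp 2 fun i => (w i).im) i := by
  simp only [sigma, inner_sum, sq]
  rfl

lemma isotropic_re_im {w : Fin 3 → ℂ} (hw : w ≠ 0) (hi : w ⬝ᵥ w = 0) :
    (w 0).re ^ 2 + (w 1).re ^ 2 + (w 2).re ^ 2 ≠ 0 ∧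
      (w 0).re ^ 2 + (w 1).re ^ 2 + (w 2).re ^ 2 = (w 0).im ^ 2 + (w 1).im ^ 2 + (w 2).im ^ 2 ∧
      (w 0).re * (w 0).im + (w 1).re * (w 1).im + (w 2).re * (w 2).im = 0 := by
  have h1 := congrArg Complex.re hi
  have h2 := congrArg Complex.im hi
  simp [dotProduct, Fin.sum_univ_three] at h1 h2
  refine ⟨fun h => hw (funext fun i => ?_), by linarith, by linarith⟩
  have hre : ∀ i, (w i).re = 0 := by
    intro i
    fin_cases i <;> simp <;> nlinarith [sq_nonneg (w 0).re, sq_nonneg (w 1).re, sq_nonneg (w 2).re]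
  have him : ∀ i, (w i).im = 0 := by
    intro i
    fin_cases i <;> simp <;> nlinarith [sq_nonneg (w 0).im, sq_nonneg (w 1).im, sq_nonneg (w 2).im]
  exact Complex.ext (hre i) (him i)

/-- Isotropy of `w = x + i y` means `|x| = |y|` and `x ⊥ y`, so `s = x × y / |x|²` satisfies `s × x
= y` and `s × y = -x`. -/
lemma isNullOver_sigma {w : Fin 3 → ℂ} (hw : w ≠ 0) (hi : w ⬝ᵥ w = 0) :
    IsNullOver (sigma w) w := by
  obtain ⟨hN, hxx, hxy⟩ := isotropic_re_im hw hi
  have hr := inv_mul_cancel₀ hN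
  have hsig := sigma_apply w
  generalize ((w 0).re ^ 2 + (w 1).re ^ 2 + (w 2).re ^ 2)⁻¹ = r at hr hsig
  constructor <;> rw [hsig, hsig] <;>
    apply Complex.ext <;> simp [cross_apply0, cross_apply1, cross_apply2] <;> grind

lemma nullVec_ne_zero (κ u : ℂ) : nullVec κ u ≠ 0 := by
  intro h
  have h0 := congrFun h 0
  have h1 := congrFun h 1
  have h2 := congrFun h 2
  simp [nullVec] at h0 h1 h2
  grind

/-- From `s × x = y` and `s ⊥ x` follows `x × y = x × (s × x) = |x|² s`. -/
lemma IsNullOver.eq_sigma {s : E3} {w : Fin 3 → ℂ} (h : IsNullOver s w) (hw : w ≠ 0) :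
    s = sigma w := by
  have hi : w ⬝ᵥ w = 0 := by
    simpa [dotProduct, Fin.sum_univ_three, sq] using h.isotropic
  obtain ⟨hN, -, -⟩ := isotropic_re_im hw hi
  have hr := inv_mul_cancel₀ hN
  have hsig := sigma_apply w
  generalize ((w 0).re ^ 2 + (w 1).re ^ 2 + (w 2).re ^ 2)⁻¹ = r at hr hsig
  have hd := congrArg Complex.re h.dotC_eq_zero
  have h0 := congrArg Complex.re h.eq0
  have h1 := congrArg Complex.re h.eq1
  have h2 := congrArg Complex.re h.eq2
  simp [dotC] at hd h0 h1 h2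
  ext i
  rw [hsig]
  fin_cases i <;> simp [cross_apply0, cross_apply1, cross_apply2] <;> beta_reduce at * <;> grind

/-- If `a w = i t` with `t` real, isotropy gives `|t|² = 0`. This upgrades real vector identities to
complex scalar ones, both for `dω` and for the Weierstrass form of `dε`. -/
lemma re_smul_eq_zero {w : Fin 3 → ℂ} (hw : w ≠ 0) (hi : w 0 ^ 2 + w 1 ^ 2 + w 2 ^ 2 = 0)
    {a : ℂ} (h : ∀ i, (a * w i).re = 0) : a = 0 := by
  have him : (a * w 0).im ^ 2 + (a * w 1).im ^ 2 + (a * w 2).im ^ 2 = 0 := by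
    have h1 : (a * w 0) ^ 2 + (a * w 1) ^ 2 + (a * w 2) ^ 2 = 0 := by
      linear_combination a ^ 2 * hi
    have h2 := congrArg Complex.re h1
    simp only [sq, Complex.add_re, Complex.mul_re (a * w _), h, Complex.zero_re] at h2
    linarith
  have h0 : ∀ i, a * w i = 0 := by
    intro i
    refine Complex.ext (h i) ?_
    fin_cases i <;> simp only [Complex.zero_im, Fin.zero_eta, Fin.mk_one, Fin.reduceFinMk] <;>
      nlinarith [sq_nonneg (a * w 0).im, sq_nonneg (a * w 1).im, sq_nonneg (a * w 2).im]
  by_contra ha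
  exact hw (funext fun i => (mul_eq_zero.1 (h0 i)).resolve_left ha)

lemma eq_I_or_eq_neg_I {κ : ℂ} (hκ : κ ^ 2 = -1) : κ = Complex.I ∨ κ = -Complex.I := by
  rwa [← sq_eq_sq_iff_eq_or_eq_neg, Complex.I_sq]

lemma I_mul_ne_zero {κ : ℂ} (hκ : κ ^ 2 = -1) : Complex.I * κ ≠ 0 :=
  mul_ne_zero Complex.I_ne_zero fun h => by simp [h] at hκ

lemma nullVec_normSq {κ : ℂ} (hκ : κ ^ 2 = -1) (u : ℂ) :
    Complex.normSq (nullVec κ u 0) + Complex.normSq (nullVec κ u 1) +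
      Complex.normSq (nullVec κ u 2) = (1 + Complex.normSq u) ^ 2 / 2 := by
  rcases eq_I_or_eq_neg_I hκ with rfl | rfl <;> simp [nullVec, Complex.normSq_apply, pow_two] <;> ring

/-! ### Coordinates on `Q` -/

/-- The isotropic vector `v + i (s × v)`. -/
def isoVec (s : S2) (v : {v : TS s // ‖(v : E3)‖ = 1}) : Fin 3 → ℂ := (frameSO s v).1 *ᵥ v0

/-- The fibre coordinate of `SO(3,ℂ) ×_B ℂ` belonging to `κ`, as a function on the ambient
vector space of `Q`. -/
def fibC (κ : ℂ) (p : Amb) : ℂ :=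
  (1 / 2) * ∑ i, ∑ j, nullVec κ (stereo κ p.1) i * nullVec κ (stereo κ p.1) j *
    (p.2 (EuclideanSpace.single j 1) i : ℂ)

section

variable (s : S2) (v : {v : TS s // ‖(v : E3)‖ = 1})

lemma isoVec_apply (i : Fin 3) :
    isoVec s v i = ((v.1 : E3) i : ℂ) + Complex.I * (cross s v.1 i : ℂ) := frameSO_v0 s v i

lemma isNullOver_isoVec : IsNullOver s (isoVec s v) := isNullOver_frame s v

lemma isoVec_conj_self :
    conj (isoVec s v 0) * isoVec s v 0 + conj (isoVec s v 1) * isoVec s v 1 +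
      conj (isoVec s v 2) * isoVec s v 2 = 2 := by
  have h1 := sq_sum _ v.2
  have h2 := sq_sum _ (norm_cross v.1.2 v.2)
  simp only [isoVec_apply]
  apply Complex.ext
  · simp
    beta_reduce at *
    linarith
  · simp
    ring

lemma isoVec_ne_zero : isoVec s v ≠ 0 := by
  intro h
  have := isoVec_conj_self s v
  simp [h] at this

/-- Pairing with `w = v + i (s × v)` is the identification of `T_s S` with `ℂ`;
`re_conj_dotC_isoVec` is its inverse `ξ ↦ Re (ξ̄ w)`. -/
lemma dotC_isoVec (t : E3) :
    dotC t (isoVec s v) = (⟪(v.1 : E3), t⟫_ℝ : ℂ) + Complex.I * (⟪cross s v.1, t⟫_ℝ : ℂ) := by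
  simp only [dotC, isoVec_apply, inner_sum]
  push_cast
  ring

lemma re_conj_dotC_isoVec {t : E3} (ht : t ∈ TS s) (i : Fin 3) :
    (conj (dotC t (isoVec s v)) * isoVec s v i).re = t i := by
  conv_rhs => rw [tangent_decomp v.1.2 v.2 ht]
  rw [dotC_isoVec, isoVec_apply]
  simp

end

/-! ### Elements of `Q` as conjugate linear maps -/

section

variable (q : Q) (v : {v : TS q.base // ‖(v : E3)‖ = 1})

/-- The matrix `(a, b; b, -a)` acts on `ξ = x · w` as `ξ ↦ (a + i b) ξ̄`; now apply the inverse
identification `η ↦ Re (η̄ w)`. -/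
lemma op_apply (x : TS q.base) (i : Fin 3) :
    (q.op x : E3) i =
      (conj (fibreCoord q v) * dotC x (isoVec q.base v) * isoVec q.base v i).re := by
  set w : TS q.base := ⟨_, cross_mem q.base v.1⟩ with hw
  have hdiag := diag_neg q v
  have hsym : ⟪(v.1 : E3), (q.op w : E3)⟫_ℝ = ⟪cross q.base v.1, (q.op v.1 : E3)⟫_ℝ := by
    have h := q.symm v.1 w
    rw [Submodule.coe_inner, Submodule.coe_inner] at h
    rw [← h, real_inner_comm]
  have hx : x = ⟪(v.1 : E3), x⟫_ℝ • v.1 + ⟪cross q.base v.1, x⟫_ℝ • w :=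
    Subtype.ext (tangent_decomp v.1.2 v.2 x.2)
  have h1 := tangent_decomp v.1.2 v.2 (q.op v.1).2
  have h2 := tangent_decomp v.1.2 v.2 (q.op w).2
  rw [hdiag, hsym] at h2
  have h3 : (q.op x : E3) = ⟪(v.1 : E3), x⟫_ℝ • (q.op v.1 : E3) +
      ⟪cross q.base v.1, x⟫_ℝ • (q.op w : E3) := by
    conv_lhs => rw [hx]
    simp
  rw [h3, h1, h2, dotC_isoVec, isoVec_apply, fibreCoord]
  simp
  ring

lemma dotC_op (x : TS q.base) :
    dotC (q.op x) (isoVec q.base v) =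
      fibreCoord q v * conj (dotC x (isoVec q.base v)) := by
  have h1 := (isNullOver_isoVec q.base v).isotropic
  have h2 := isoVec_conj_self q.base v
  have hre : ∀ a : ℂ, (a.re : ℂ) = (a + conj a) / 2 := Complex.re_eq_add_conj
  rw [dotC, op_apply q v, op_apply q v, op_apply q v]
  simp only [hre, map_mul, Complex.conj_conj]
  linear_combination (conj (fibreCoord q v) * dotC x (isoVec q.base v)) / 2 * h1 +
    fibreCoord q v * conj (dotC x (isoVec q.base v)) / 2 * h2

lemma op_op (x : TS q.base) : q.op (q.op x) = Complex.normSq (fibreCoord q v) • x := by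
  ext i
  rw [op_apply q v, dotC_op, ← mul_assoc, ← Complex.normSq_eq_conj_mul_self, mul_assoc,
    Complex.re_ofReal_mul, re_conj_dotC_isoVec q.base v x.2]
  simp

lemma op_eq_zero_iff : q.op = 0 ↔ fibreCoord q v = 0 := by
  constructor
  · intro h
    simp [fibreCoord, h]
  · intro h
    ext x i
    rw [op_apply q v, h]
    simp

lemma inverse_op (h : fibreCoord q v ≠ 0) :
    Ring.inverse q.op = (Complex.normSq (fibreCoord q v))⁻¹ • q.op := by
  have hn : Complex.normSq (fibreCoord q v) ≠ 0 := by simpa using h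
  have hl : ((Complex.normSq (fibreCoord q v))⁻¹ • q.op) * q.op = 1 := by
    ext1 x
    simp [op_op q v, smul_smul, hn]
  have hr : q.op * ((Complex.normSq (fibreCoord q v))⁻¹ • q.op) = 1 := by
    ext1 x
    simp [op_op q v, smul_smul, hn]
  exact Ring.inverse_unit ⟨q.op, _, hr, hl⟩

/-- The real and imaginary parts of `w` are tangent, so the normal component of `t` does not
contribute. -/
lemma dotC_proj (t : E3) :
    dotC ((TS q.base).orthogonalProjectionOnto t : E3) (isoVec q.base v) =
      dotC t (isoVec q.base v) := by
  have h : ∀ x : TS q.base, ⟪(x : E3), ((TS q.base).orthogonalProjectionOnto t : E3)⟫_ℝ =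
      ⟪(x : E3), t⟫_ℝ := fun x =>
    (Submodule.coe_inner _ _ _).symm.trans
      (Submodule.inner_orthogonalProjectionOnto_eq_of_mem_left x t)
  rw [dotC_isoVec, dotC_isoVec, h v.1, h ⟨_, cross_mem q.base v.1⟩]

lemma embed_snd_apply (t : E3) (i : Fin 3) :
    (embed q).2 t i =
      (conj (fibreCoord q v) * dotC t (isoVec q.base v) * isoVec q.base v i).re := by
  rw [← dotC_proj q v]
  exact op_apply q v _ i

lemma omega_apply_isoVec (h : fibreCoord q v ≠ 0) (δ : Amb) (i : Fin 3) :
    omega q δ i =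
      ((fibreCoord q v)⁻¹ * dotC δ.1 (isoVec q.base v) * isoVec q.base v i).re := by
  have h1 : omega q δ = (Complex.normSq (fibreCoord q v))⁻¹ •
      (q.op ((TS q.base).orthogonalProjectionOnto δ.1) : E3) := by
    simp [omega, inverse_op q v h]
  rw [h1, PiLp.smul_apply, op_apply q v, dotC_proj, smul_eq_mul, ← Complex.re_ofReal_mul,
    Complex.inv_def]
  congr 1
  push_cast
  ring

end

/-! ### `Q` in the charts `(u, ζ)` -/

section

variable {κ : ℂ} (hκ : κ ^ 2 = -1) (q : Q)
include hκ

lemma mem_chartDom_iff : toAssoc q ∈ chartDom κ ↔ stereoDen κ q.base ≠ 0 := by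
  obtain ⟨v, hv⟩ := exists_unit q.base
  rw [toAssoc_eq q ⟨v, hv⟩]
  exact (isNullOver_isoVec q.base ⟨v, hv⟩).den_ne_zero_iff (isoVec_ne_zero _ _) hκ (norm_base _)

variable (hs : stereoDen κ q.base ≠ 0)
include hs

/-- The factor `d` between the unit frame and the Weierstrass vector governs every change to chart
coordinates. Its modulus comes from comparing `|v + i (s × v)|² = 2` with `|w(u)|² = (1 + |u|²)² /
2`. -/
lemma exists_den (v : {v : TS q.base // ‖(v : E3)‖ = 1}) :
    ∃ d : ℂ, d ≠ 0 ∧ isoVec q.base v = d • nullVec κ (stereo κ q.base) ∧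
      Complex.normSq d = 4 / (1 + Complex.normSq (stereo κ q.base)) ^ 2 ∧
      fibreCoord q v = d ^ 2 * fibC κ (embed q) ∧
      chartFun κ (toAssoc q) = (stereo κ q.base, fibC κ (embed q)) := by
  have hN := isNullOver_isoVec q.base v
  have hd := (hN.den_ne_zero_iff (isoVec_ne_zero _ _) hκ (norm_base _)).2 hs
  have h1 := hN.eq_smul_nullVec hκ hd
  have hst := hN.stereo_eq hκ hd hs
  rw [hst] at h1
  obtain ⟨d, hdd⟩ : ∃ d, d = isoVec q.base v 0 + κ * isoVec q.base v 1 := ⟨_, rfl⟩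
  rw [← hdd] at hd h1 hst
  have hi := hN.isotropic
  have hc := isoVec_conj_self q.base v
  have hf : fibreCoord q v = d ^ 2 * fibC κ (embed q) := by
    have hre : ∀ a : ℂ, (a.re : ℂ) = (a + conj a) / 2 := Complex.re_eq_add_conj
    have hA : ∀ i j, ((embed q).2 (EuclideanSpace.single j 1) i : ℂ) =
        (conj (fibreCoord q v) * isoVec q.base v j * isoVec q.base v i +
          fibreCoord q v * conj (isoVec q.base v j) * conj (isoVec q.base v i)) / 2 := by
      intro i j
      have : dotC (EuclideanSpace.single j 1) (isoVec q.base v) = isoVec q.base v j := by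
        fin_cases j <;> simp [dotC]
      rw [embed_snd_apply q v, hre, this]
      simp
    have hw : ∀ i, isoVec q.base v i = d * nullVec κ (stereo κ q.base) i := fun i =>
      congrFun h1 i
    have hfib : d ^ 2 * fibC κ (embed q) = (1 / 2) * ∑ i, ∑ j, isoVec q.base v i *
        isoVec q.base v j * ((embed q).2 (EuclideanSpace.single j 1) i : ℂ) := by
      have hb : (embed q).1 = q.base := rfl
      rw [fibC, mul_left_comm, Finset.mul_sum, hb]
      congr 1
      refine Finset.sum_congr rfl fun i _ => ?_
      rw [Finset.mul_sum]
      refine Finset.sum_congr rfl fun j _ => ?_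
      rw [hw i, hw j]
      ring
    rw [hfib]
    simp only [hA, Fin.sum_univ_three]
    generalize isoVec q.base v = w at hi hc
    -- With `A = Re (z̄ w wᵀ)` one has `½ wᵀ A w = ¼ (z̄ (w · w)² + z (w̄ · w)²) = z`, since `w · w
    -- = 0` and `w̄ · w = 2`.
    linear_combination (-(1 / 4) * conj (fibreCoord q v) * (w 0 ^ 2 + w 1 ^ 2 + w 2 ^ 2)) * hi -
      (1 / 4) * fibreCoord q v * (conj (w 0) * w 0 + conj (w 1) * w 1 + conj (w 2) * w 2 + 2) * hc
  refine ⟨d, hd, h1, ?_, hf, ?_⟩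
  · have hn := nullVec_normSq hκ (stereo κ q.base)
    have hpos : 0 < 1 + Complex.normSq (stereo κ q.base) := by
      have := Complex.normSq_nonneg (stereo κ q.base)
      linarith
    have h2 : Complex.normSq d * ((1 + Complex.normSq (stereo κ q.base)) ^ 2 / 2) = 2 := by
      rw [h1] at hc
      simp only [← Complex.normSq_eq_conj_mul_self, Pi.smul_apply, smul_eq_mul,
        Complex.normSq_mul] at hc
      rw [← hn]
      have : Complex.normSq d * Complex.normSq (nullVec κ (stereo κ q.base) 0) +
          Complex.normSq d * Complex.normSq (nullVec κ (stereo κ q.base) 1) +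
          Complex.normSq d * Complex.normSq (nullVec κ (stereo κ q.base) 2) = 2 := by
        exact_mod_cast hc
      linarith
    field_simp
    linarith
  · rw [toAssoc_eq q v]
    change (isoVec q.base v 2 / (isoVec q.base v 0 + κ * isoVec q.base v 1),
      fibreCoord q v / (isoVec q.base v 0 + κ * isoVec q.base v 1) ^ 2) = _
    rw [← hdd, hst, hf, mul_div_cancel_left₀ _ (pow_ne_zero 2 hd)]

lemma chartFun_toAssoc :
    chartFun κ (toAssoc q) = (stereo κ q.base, fibC κ (embed q)) := by
  obtain ⟨v, hv⟩ := exists_unit q.base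
  obtain ⟨d, -, -, -, -, h⟩ := exists_den hκ q hs ⟨v, hv⟩
  exact h

lemma isNullOver_nullVec : IsNullOver q.base (nullVec κ (stereo κ q.base)) := by
  obtain ⟨v, hv⟩ := exists_unit q.base
  obtain ⟨d, hd, h, -⟩ := exists_den hκ q hs ⟨v, hv⟩
  have := (isNullOver_isoVec q.base ⟨v, hv⟩).smul d⁻¹
  rwa [h, smul_smul, inv_mul_cancel₀ hd, one_smul] at this

lemma op_eq_zero_iff_fibC : q.op = 0 ↔ fibC κ (embed q) = 0 := by
  obtain ⟨v, hv⟩ := exists_unit q.base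
  obtain ⟨d, hd, -, -, h, -⟩ := exists_den hκ q hs ⟨v, hv⟩
  rw [op_eq_zero_iff q ⟨v, hv⟩, h]
  simp [hd]

/-- The real factor is `|d|⁴`. The formula expresses the operator part of the embedding smoothly in
`(u, ζ)`. -/
lemma embed_snd_eq (t : E3) (i : Fin 3) :
    (embed q).2 t i = (16 / (1 + Complex.normSq (stereo κ q.base)) ^ 4 *
      (conj (fibC κ (embed q)) * dotC t (nullVec κ (stereo κ q.base)) *
        nullVec κ (stereo κ q.base) i)).re := by
  obtain ⟨v, hv⟩ := exists_unit q.base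
  obtain ⟨d, hd, hw, hn, h, -⟩ := exists_den hκ q hs ⟨v, hv⟩
  rw [embed_snd_apply q ⟨v, hv⟩, h, hw, dotC_smul]
  congr 1
  have hn2 : conj d * d = 4 / (1 + Complex.normSq (stereo κ q.base)) ^ 2 := by
    rw [← Complex.normSq_eq_conj_mul_self, hn]
    push_cast
    rfl
  have : (16 : ℂ) / (1 + Complex.normSq (stereo κ q.base)) ^ 4 = (conj d * d) ^ 2 := by
    rw [hn2, div_pow]
    norm_num
    ring
  rw [this]
  simp only [Pi.smul_apply, smul_eq_mul, map_mul, map_pow]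
  ring

/-- Here `z⁻¹ = d⁻² ζ⁻¹` cancels the two factors `d` of `w`, so unlike in `embed_snd_eq` no `|d|`
remains and the coefficient is holomorphic in `(u, ζ)`. -/
lemma omega_apply (hz : fibC κ (embed q) ≠ 0) (δ : Amb) (i : Fin 3) :
    omega q δ i = ((fibC κ (embed q))⁻¹ * dotC δ.1 (nullVec κ (stereo κ q.base)) *
        nullVec κ (stereo κ q.base) i).re := by
  obtain ⟨v, hv⟩ := exists_unit q.base
  obtain ⟨d, hd, hw, hn, h, -⟩ := exists_den hκ q hs ⟨v, hv⟩
  have h0 : fibreCoord q ⟨v, hv⟩ ≠ 0 := by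
    rw [h]
    exact mul_ne_zero (pow_ne_zero 2 hd) hz
  rw [omega_apply_isoVec q ⟨v, hv⟩ h0, h, hw, dotC_smul]
  congr 1
  simp only [Pi.smul_apply, smul_eq_mul]
  field_simp

lemma dotC_op_nullVec (x : TS q.base) :
    dotC (q.op x) (nullVec κ (stereo κ q.base)) =
      4 / (1 + Complex.normSq (stereo κ q.base)) ^ 2 * fibC κ (embed q) *
        conj (dotC x (nullVec κ (stereo κ q.base))) := by
  obtain ⟨v, hv⟩ := exists_unit q.base
  obtain ⟨d, hd, hw, hn, h, -⟩ := exists_den hκ q hs ⟨v, hv⟩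
  have hn2 : conj d * d = 4 / (1 + Complex.normSq (stereo κ q.base)) ^ 2 := by
    rw [← Complex.normSq_eq_conj_mul_self, hn]
    push_cast
    rfl
  have := dotC_op q ⟨v, hv⟩ x
  rw [h, hw, dotC_smul, dotC_smul, map_mul] at this
  rw [← hn2]
  apply mul_left_cancel₀ hd
  rw [this]
  ring

/-- The vector is `w'(u)`. This constant is what turns `d (s · w(u)) = 0` into `ds · w(u) = -iκ du`.
-/
lemma dotC_nullVec_deriv :
    dotC q.base ![-stereo κ q.base, -κ * stereo κ q.base, 1] = Complex.I * κ := by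
  have h1 := sq_sum _ (norm_base q.base)
  have h2 : ((q.base : E3) 0 : ℂ) ^ 2 + ((q.base : E3) 1 : ℂ) ^ 2 +
    ((q.base : E3) 2 : ℂ) ^ 2 = 1 := by
    rw [← Complex.ofReal_one, ← h1]
    push_cast
    rfl
  have hI : Complex.I ^ 2 = -1 := Complex.I_sq
  have hu : stereo κ q.base * stereoDen κ q.base =
      -(Complex.I * κ * (q.base : E3) 0 + Complex.I * (q.base : E3) 1) := div_mul_cancel₀ _ hs
  apply mul_left_cancel₀ hs
  simp only [dotC, stereoDen, Matrix.cons_val] at hu ⊢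
  generalize stereo κ q.base = u at hu
  grind

end

/-! ### Derivatives of the coordinates -/

lemma contDiff_ofReal_coord (i : Fin 3) : ContDiff ℝ ∞ fun s : E3 => (s i : ℂ) :=
  Complex.ofRealCLM.contDiff.comp (EuclideanSpace.proj i : E3 →L[ℝ] ℝ).contDiff

lemma contDiff_stereoDen (κ : ℂ) : ContDiff ℝ ∞ (stereoDen κ) := by
  have h2 := contDiff_ofReal_coord 2
  unfold stereoDen
  fun_prop

lemma contDiffAt_stereo {κ : ℂ} {s : E3} (hs : stereoDen κ s ≠ 0) :
    ContDiffAt ℝ ∞ (stereo κ) s := by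
  have h0 := contDiff_ofReal_coord 0
  have h1 := contDiff_ofReal_coord 1
  unfold stereo
  simp only [div_eq_mul_inv]
  refine ContDiffAt.mul ?_ ((contDiff_stereoDen κ).contDiffAt.inv hs)
  fun_prop

lemma contDiffAt_nullVec {E : Type*} [NormedAddCommGroup E] [NormedSpace ℝ E] {u : E → ℂ} {x : E}
    (κ : ℂ) (hu : ContDiffAt ℝ ∞ u x) (i : Fin 3) :
    ContDiffAt ℝ ∞ (fun y => nullVec κ (u y) i) x := by
  fin_cases i <;> simp only [nullVec, Fin.zero_eta, Fin.mk_one, Fin.reduceFinMk, Matrix.cons_val] <;>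
    fun_prop

lemma contDiffAt_fibC {κ : ℂ} {p : Amb} (hs : stereoDen κ p.1 ≠ 0) :
    ContDiffAt ℝ ∞ (fibC κ) p := by
  have hu : ContDiffAt ℝ ∞ (fun p : Amb => stereo κ p.1) p :=
    (contDiffAt_stereo hs).comp p contDiffAt_fst
  have hA : ∀ i j, ContDiffAt ℝ ∞
      (fun p : Amb => (p.2 (EuclideanSpace.single j 1) i : ℂ)) p := fun i j =>
    ((contDiff_ofReal_coord i).comp (contDiff_snd.clm_apply contDiff_const)).contDiffAt
  unfold fibC
  refine contDiffAt_const.mul (ContDiffAt.sum fun i _ => ContDiffAt.sum fun j _ => ?_)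
  exact ((contDiffAt_nullVec κ hu i).mul (contDiffAt_nullVec κ hu j)).mul (hA i j)

lemma hasFDerivAt_nullVec {κ : ℂ} {u : ℂ → ℂ} {z : ℂ} (hu : DifferentiableAt ℝ u z) (i : Fin 3) :
    HasFDerivAt (fun y => nullVec κ (u y) i) (![-u z, -κ * u z, 1] i • fderiv ℝ u z) z := by
  have h := hu.hasFDerivAt
  fin_cases i
  · simp only [nullVec, Fin.zero_eta, Matrix.cons_val]
    have e : (fun y => (1 - u y ^ 2) / 2) = fun y => (1 - u y ^ 2) * (1 / 2) := by
      ext y; ring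
    rw [e]
    exact (((h.pow 2).const_sub 1).mul_const (1 / 2)).congr_fderiv (by ext1 v; simp; ring)
  · simp only [nullVec, Fin.mk_one, Matrix.cons_val]
    have e : (fun y => -κ * (1 + u y ^ 2) / 2) = fun y => (-κ / 2) * (1 + u y ^ 2) := by
      ext y; ring
    rw [e]
    exact (((h.pow 2).const_add 1).const_mul (-κ / 2)).congr_fderiv (by ext1 v; simp; ring)
  · simpa [nullVec] using h

lemma hasFDerivAt_ofReal_coord {s : ℂ → E3} {z : ℂ} (hs : DifferentiableAt ℝ s z) (i : Fin 3) :
    HasFDerivAt (fun y => (s y i : ℂ))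
      ((Complex.ofRealCLM ∘L (EuclideanSpace.proj i : E3 →L[ℝ] ℝ)) ∘L fderiv ℝ s z) z :=
  (Complex.ofRealCLM ∘L (EuclideanSpace.proj i : E3 →L[ℝ] ℝ)).hasFDerivAt.comp z hs.hasFDerivAt

section

variable {κ : ℂ} {ψ : ℂ → Q} {z : ℂ}

/-- The stereographic coordinate is a holomorphic coordinate: `⟨ds, w⟩ = -i κ du`. -/
lemma dotC_fderiv_base (hκ : κ ^ 2 = -1) (hs : DifferentiableAt ℝ (fun y => ((ψ y).base : E3)) z)
    (hden : stereoDen κ (ψ z).base ≠ 0) (v : ℂ) :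
    dotC (fderiv ℝ (fun y => ((ψ y).base : E3)) z v) (nullVec κ (stereo κ (ψ z).base)) =
      -(Complex.I * κ) * fderiv ℝ (fun y => stereo κ (ψ y).base) z v := by
  have hu : DifferentiableAt ℝ (fun y => stereo κ (ψ y).base) z :=
    DifferentiableAt.comp (g := stereo κ) z
      ((contDiffAt_stereo hden).differentiableAt (by simp)) hs
  have hev : ∀ᶠ y in nhds z, stereoDen κ (ψ y).base ≠ 0 :=
    ((contDiff_stereoDen κ).continuous.continuousAt.comp hs.continuousAt).eventually_ne hden
  have h0 : (fun y => dotC (ψ y).base (nullVec κ (stereo κ (ψ y).base))) =ᶠ[nhds z] fun _ => 0 := by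
    filter_upwards [hev] with y hy
    exact (isNullOver_nullVec hκ (ψ y) hy).dotC_eq_zero
  have h1 := fun i => (hasFDerivAt_ofReal_coord hs i).mul (hasFDerivAt_nullVec (κ := κ) hu i)
  have h2 := ((h1 0).add (h1 1)).add (h1 2)
  have h3 := h2.unique ((hasFDerivAt_const (0 : ℂ) z).congr_of_eventuallyEq h0)
  have h4 := DFunLike.congr_fun h3 v
  have h5 := dotC_nullVec_deriv hκ (ψ z) hden
  rw [dotC] at h5 ⊢
  simp at h4 h5
  rw [neg_mul, ← h5]
  linear_combination h4

end

lemma extDeriv_ofSubsingleton_apply {L : ℂ → ℂ →L[ℝ] E3} {z : ℂ} (hL : DifferentiableAt ℝ L z)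
    (v : Fin 2 → ℂ) :
    extDeriv (fun y => ContinuousAlternatingMap.ofSubsingleton ℝ ℂ E3 (0 : Fin 1) (L y)) z v =
      fderiv ℝ L z (v 0) (v 1) - fderiv ℝ L z (v 1) (v 0) := by
  have hd : DifferentiableAt ℝ
      (fun y => ContinuousAlternatingMap.ofSubsingleton ℝ ℂ E3 (0 : Fin 1) (L y)) z :=
    DifferentiableAt.comp (g := ContinuousAlternatingMap.ofSubsingletonLIE (𝕜 := ℝ) (E := ℂ) (F := E3)
      (0 : Fin 1)) z
      (LinearIsometryEquiv.differentiable _ _) hL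
  have h : ∀ a b, fderiv ℝ (fun y => L y b) z a = fderiv ℝ L z a b := by
    intro a b
    rw [fderiv_clm_apply hL (differentiableAt_const b)]
    simp
  rw [extDeriv_apply hd]
  simp [Fin.sum_univ_two, h, Fin.removeNth]
  rw [sub_eq_add_neg]
/-- The exterior derivative of the `ℝ³`-valued one-form `Re (k du)`. -/
lemma extDeriv_re_mul_fderiv {L : ℂ → ℂ →L[ℝ] E3} {k : ℂ → Fin 3 → ℂ} {u : ℂ → ℂ} {z : ℂ}
    (hu : ContDiffAt ℝ 2 u z) (hk : ∀ i, ContDiffAt ℝ 1 (fun y => k y i) z)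
    (hL : ∀ᶠ y in nhds z, ∀ v i, L y v i = (k y i * fderiv ℝ u y v).re) (v : Fin 2 → ℂ)
    (i : Fin 3) :
    extDeriv (fun y => ContinuousAlternatingMap.ofSubsingleton ℝ ℂ E3 (0 : Fin 1) (L y)) z v i =
      (fderiv ℝ (fun y => k y i) z (v 0) * fderiv ℝ u z (v 1) -
        fderiv ℝ (fun y => k y i) z (v 1) * fderiv ℝ u z (v 0)).re := by
  have hu1 : ContDiffAt ℝ 1 (fderiv ℝ u) z := hu.fderiv_right (by norm_num)
  have hLd : ContDiffAt ℝ 1 L z := by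
    -- `L` is only known through its components; reassembling it from them shows that it is `C¹`.
    have h1 : ContDiffAt ℝ 1 (fun y => ∑ i, (Complex.reCLM ∘L (k y i • fderiv ℝ u y)).smulRight
        (EuclideanSpace.single i (1 : ℝ) : E3)) z := by
      refine ContDiffAt.sum fun i _ => ContDiffAt.smulRight ?_ contDiffAt_const
      exact contDiffAt_const.clm_comp ((hk i).smul hu1)
    refine h1.congr_of_eventuallyEq ?_
    filter_upwards [hL] with y hy
    ext v i
    rw [hy]
    simp [Fin.sum_univ_three]
    fin_cases i <;> simp
  have hLd' := hLd.differentiableAt one_ne_zero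
  -- This is `d(du) = 0`, which leaves only `dk ∧ du`.
  have hsymm : ∀ a b, fderiv ℝ (fderiv ℝ u) z a b = fderiv ℝ (fderiv ℝ u) z b a := by
    intro a b
    exact (hu.isSymmSndFDerivAt (by simp)).eq a b
  have key : ∀ a b, fderiv ℝ L z a b i =
      (fderiv ℝ (fun y => k y i) z a * fderiv ℝ u z b + k z i *
        fderiv ℝ (fderiv ℝ u) z a b).re := by
    intro a b
    have e1 : HasFDerivAt (fun y => L y b i) ((EuclideanSpace.proj i : E3 →L[ℝ] ℝ) ∘L
        ((fderiv ℝ L z).flip b)) z := by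
      refine (EuclideanSpace.proj i : E3 →L[ℝ] ℝ).hasFDerivAt.comp z ?_
      have := hLd'.hasFDerivAt.clm_apply (hasFDerivAt_const b z)
      simpa using this
    have e2 : HasFDerivAt (fun y => fderiv ℝ u y b) ((fderiv ℝ (fderiv ℝ u) z).flip b) z := by
      have := (hu1.differentiableAt one_ne_zero).hasFDerivAt.clm_apply (hasFDerivAt_const b z)
      simpa using this
    have e3 := Complex.reCLM.hasFDerivAt.comp z
      (((hk i).differentiableAt one_ne_zero).hasFDerivAt.mul e2)
    have e4 : (fun y => L y b i) =ᶠ[nhds z]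
        (fun y => Complex.reCLM (k y i * fderiv ℝ u y b)) := by
      filter_upwards [hL] with y hy
      exact hy b i
    have := DFunLike.congr_fun (e1.unique (e3.congr_of_eventuallyEq e4)) a
    simp at this
    rw [this]
    simp
    ring
  rw [extDeriv_ofSubsingleton_apply hLd', PiLp.sub_apply, key, key, hsymm (v 1) (v 0)]
  simp

/-! ### The form `ω` in coordinates -/

/-- The real-bilinear condition that the pull-back of the two-form `dζ ∧ du` vanishes. -/
def WedgeZero (u ζ : ℂ → ℂ) (z : ℂ) : Prop :=
  ∀ v w, fderiv ℝ u z v * fderiv ℝ ζ z w = fderiv ℝ u z w * fderiv ℝ ζ z v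

lemma WedgeZero.symm {u ζ : ℂ → ℂ} {z : ℂ} (h : WedgeZero u ζ z) : WedgeZero ζ u z := by
  intro v w
  rw [mul_comm, ← h, mul_comm]

section

variable {κ : ℂ} {ψ : ℂ → Q} {O : Set ℂ}

/-- The first coordinate of a map to `Q`. -/
def coordU (κ : ℂ) (ψ : ℂ → Q) (z : ℂ) : ℂ := stereo κ (ψ z).base

/-- The second coordinate of a map to `Q`. -/
def coordZ (κ : ℂ) (ψ : ℂ → Q) (z : ℂ) : ℂ := fibC κ (embed (ψ z))

lemma contDiffAt_base {z : ℂ} (hψ : ContDiffAt ℝ ∞ (embed ∘ ψ) z) :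
    ContDiffAt ℝ ∞ (fun y => ((ψ y).base : E3)) z :=
  (contDiff_fst (E := E3) (F := E3 →L[ℝ] E3)).contDiffAt.comp z hψ

lemma contDiffAt_coordU {z : ℂ} (hψ : ContDiffAt ℝ ∞ (embed ∘ ψ) z)
    (hd : stereoDen κ (ψ z).base ≠ 0) : ContDiffAt ℝ ∞ (coordU κ ψ) z :=
  ContDiffAt.comp (g := stereo κ) z (contDiffAt_stereo hd) (contDiffAt_base hψ)

lemma contDiffAt_coordZ {z : ℂ} (hψ : ContDiffAt ℝ ∞ (embed ∘ ψ) z)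
    (hd : stereoDen κ (ψ z).base ≠ 0) : ContDiffAt ℝ ∞ (coordZ κ ψ) z :=
  ContDiffAt.comp (g := fibC κ) z (contDiffAt_fibC (p := embed (ψ z)) hd) hψ

/-- In coordinates `ω = Re (k du)` with `k = -iκ ζ⁻¹ w(u)`. The derivative of `w(u)` contributes
only `du ∧ du = 0`, leaving `Re (iκ ζ⁻² w(u) dζ ∧ du)`. -/
lemma extDeriv_omega_eq_zero_iff (hκ : κ ^ 2 = -1) (hO : IsOpen O)
    (hψ : ∀ y ∈ O, ContDiffAt ℝ ∞ (embed ∘ ψ) y) (hd : ∀ y ∈ O, stereoDen κ (ψ y).base ≠ 0)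
    {z : ℂ} (hz : z ∈ O) (h0 : coordZ κ ψ z ≠ 0) :
    extDeriv (fun y => ContinuousAlternatingMap.ofSubsingleton ℝ ℂ E3 (0 : Fin 1)
      (omega (ψ y) ∘L fderiv ℝ (embed ∘ ψ) y)) z = 0 ↔ WedgeZero (coordU κ ψ) (coordZ κ ψ) z := by
  have hU := fun y hy => contDiffAt_coordU (hψ y hy) (hd y hy)
  have hZ := fun y hy => contDiffAt_coordZ (hψ y hy) (hd y hy)
  have hI := I_mul_ne_zero hκ
  set k : ℂ → Fin 3 → ℂ := fun y i =>
    (-(Complex.I * κ)) * (coordZ κ ψ y)⁻¹ * nullVec κ (coordU κ ψ y) i with hk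
  have hL : ∀ᶠ y in nhds z, ∀ v i, (omega (ψ y) ∘L fderiv ℝ (embed ∘ ψ) y) v i =
      (k y i * fderiv ℝ (coordU κ ψ) y v).re := by
    filter_upwards [hO.mem_nhds hz, (hZ z hz).continuousAt.eventually_ne h0] with y hy hy0 v i
    have hb := contDiffAt_base (hψ y hy)
    have hds := dotC_fderiv_base hκ (hb.differentiableAt (by simp)) (hd y hy) v
    have hfst : (fderiv ℝ (embed ∘ ψ) y v).1 = fderiv ℝ (fun y => ((ψ y).base : E3)) y v := by
      have h := ((hψ y hy).differentiableAt (by simp)).hasFDerivAt.fst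
      exact (DFunLike.congr_fun h.fderiv v).symm
    rw [ContinuousLinearMap.comp_apply, omega_apply hκ (ψ y) (hd y hy) hy0, hfst, hds]
    change ((coordZ κ ψ y)⁻¹ * (-(Complex.I * κ) * fderiv ℝ (coordU κ ψ) y v) *
      nullVec κ (coordU κ ψ y) i).re = _
    congr 1
    simp only [hk]
    ring
  have hksm : ∀ i, ContDiffAt ℝ 1 (fun y => k y i) z := by
    intro i
    have : ContDiffAt ℝ ∞ (fun y => k y i) z :=
      (contDiffAt_const.mul ((hZ z hz).inv h0)).mul (contDiffAt_nullVec κ (hU z hz) i)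
    exact this.of_le ENat.LEInfty.out
  have hdk : ∀ i v, fderiv ℝ (fun y => k y i) z v =
      Complex.I * κ * ((coordZ κ ψ z) ^ 2)⁻¹ * fderiv ℝ (coordZ κ ψ) z v *
        nullVec κ (coordU κ ψ z) i + (-(Complex.I * κ)) * (coordZ κ ψ z)⁻¹ *
        (![-coordU κ ψ z, -κ * coordU κ ψ z, 1] i * fderiv ℝ (coordU κ ψ) z v) := by
    intro i v
    have h1 := hasFDerivAt_nullVec (κ := κ) ((hU z hz).differentiableAt (by simp)) i
    have h2 := (hasFDerivAt_inv' h0).comp z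
      (((hZ z hz).differentiableAt (by simp)).hasFDerivAt)
    have h3 := (h2.const_mul (-(Complex.I * κ))).mul h1
    have h4 : fderiv ℝ (fun y => k y i) z = _ := h3.fderiv
    rw [h4]
    simp
    ring
  have hform := fun v i => extDeriv_re_mul_fderiv ((hU z hz).of_le ENat.LEInfty.out)
    hksm hL v i
  constructor
  · intro h v w
    have h1 : Complex.I * κ * ((coordZ κ ψ z) ^ 2)⁻¹ *
        (fderiv ℝ (coordZ κ ψ) z v * fderiv ℝ (coordU κ ψ) z w -
          fderiv ℝ (coordZ κ ψ) z w * fderiv ℝ (coordU κ ψ) z v) = 0 := by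
      have hN := isNullOver_nullVec hκ (ψ z) (hd z hz)
      refine re_smul_eq_zero (nullVec_ne_zero κ _) hN.isotropic fun i => ?_
      have h2 := hform ![v, w] i
      rw [h, hdk, hdk] at h2
      simp only [Matrix.cons_val_zero, Matrix.cons_val_one] at h2
      refine Eq.trans ?_ h2.symm
      congr 1
      simp only [coordU]
      ring
    have h2 := (mul_eq_zero.1 h1).resolve_left
      (mul_ne_zero hI (inv_ne_zero (pow_ne_zero 2 h0)))
    linear_combination -h2
  · intro h
    ext v i
    rw [hform, hdk, hdk]
    have h1 := h (v 0) (v 1)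
    rw [ContinuousAlternatingMap.coe_zero, Pi.zero_apply, PiLp.zero_apply, ← Complex.zero_re]
    congr 1
    linear_combination (-(Complex.I * κ * ((coordZ κ ψ z) ^ 2)⁻¹ * nullVec κ (coordU κ ψ z) i)) * h1

/-- If `dζ ∧ du` were nonzero at a point, it would be nonzero nearby, which forces `ζ = 0` nearby
and hence `dζ = 0`: a contradiction. No density of the complement of the zero section is needed. -/
lemma wedgeZero_of_forall_ne_zero (hO : IsOpen O)
    (hψ : ∀ y ∈ O, ContDiffAt ℝ ∞ (embed ∘ ψ) y) (hd : ∀ y ∈ O, stereoDen κ (ψ y).base ≠ 0)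
    (h : ∀ y ∈ O, coordZ κ ψ y ≠ 0 → WedgeZero (coordU κ ψ) (coordZ κ ψ) y) :
    ∀ y ∈ O, WedgeZero (coordU κ ψ) (coordZ κ ψ) y := by
  intro z hz v w
  by_contra hne
  have hU := contDiffAt_coordU (hψ z hz) (hd z hz)
  have hZ := contDiffAt_coordZ (hψ z hz) (hd z hz)
  have hU' := (hU.fderiv_right (m := 0) (by simp)).continuousAt
  have hZ' := (hZ.fderiv_right (m := 0) (by simp)).continuousAt
  have hev : ∀ᶠ y in nhds z, fderiv ℝ (coordU κ ψ) y v * fderiv ℝ (coordZ κ ψ) y w -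
      fderiv ℝ (coordU κ ψ) y w * fderiv ℝ (coordZ κ ψ) y v ≠ 0 := by
    refine ContinuousAt.eventually_ne ?_ (sub_ne_zero.2 hne)
    have hc : ∀ (f : ℂ → ℂ →L[ℝ] ℂ) (a : ℂ), ContinuousAt f z → ContinuousAt (fun y => f y a) z :=
      fun f a hf => hf.clm_apply continuousAt_const
    exact ((hc _ v hU').mul (hc _ w hZ')).sub ((hc _ w hU').mul (hc _ v hZ'))
  have h0 : coordZ κ ψ =ᶠ[nhds z] fun _ => 0 := by
    filter_upwards [hev, hO.mem_nhds hz] with y hy hyO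
    by_contra hy0
    exact hy (sub_eq_zero.2 (h y hyO hy0 v w))
  apply hne
  rw [h0.fderiv_eq]
  simp

lemma fderiv_mem_TS {N : ℂ → S2} {z : ℂ} (hN : DifferentiableAt ℝ (fun y => (N y : E3)) z)
    (v : ℂ) : fderiv ℝ (fun y => (N y : E3)) z v ∈ TS (N z) := by
  rw [mem_TS]
  have h1 : HasFDerivAt (fun y => ⟪(N y : E3), (N y : E3)⟫_ℝ) _ z :=
    hN.hasFDerivAt.inner ℝ hN.hasFDerivAt
  have h2 : (fun y => ⟪(N y : E3), (N y : E3)⟫_ℝ) = fun _ => 1 := by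
    ext y
    simp
  rw [h2] at h1
  have h3 := DFunLike.congr_fun (h1.unique (hasFDerivAt_const (1 : ℝ) z)) v
  simp [real_inner_comm] at h3
  linarith

/-- Tangent vectors of `Q` are determined by the derivatives of the two coordinates. -/
lemma fderiv_embed_eq_zero (hκ : κ ^ 2 = -1) {z : ℂ} (hψ : ContDiffAt ℝ ∞ (embed ∘ ψ) z)
    (hd : stereoDen κ (ψ z).base ≠ 0) {v : ℂ} (hu : fderiv ℝ (coordU κ ψ) z v = 0)
    (hz : fderiv ℝ (coordZ κ ψ) z v = 0) : fderiv ℝ (embed ∘ ψ) z v = 0 := by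
  have hb := (contDiffAt_base hψ).differentiableAt (by simp)
  have hev : ∀ᶠ y in nhds z, stereoDen κ (ψ y).base ≠ 0 :=
    ((contDiff_stereoDen κ).continuous.continuousAt.comp hb.continuousAt).eventually_ne hd
  have hφ := (hψ.differentiableAt (by simp)).hasFDerivAt
  have hfst : (fderiv ℝ (embed ∘ ψ) z v).1 = fderiv ℝ (fun y => ((ψ y).base : E3)) z v :=
    (DFunLike.congr_fun hφ.fst.fderiv v).symm
  refine Prod.ext ?_ ?_
  · rw [hfst]
    have hds := dotC_fderiv_base hκ hb hd v
    have hu' : fderiv ℝ (fun y => stereo κ (ψ y).base) z v = 0 := hu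
    rw [hu', mul_zero] at hds
    obtain ⟨e, he⟩ := exists_unit (ψ z).base
    obtain ⟨d, -, hw, -⟩ := exists_den hκ (ψ z) hd ⟨e, he⟩
    have ht : fderiv ℝ (fun y => ((ψ y).base : E3)) z v ∈ TS (ψ z).base :=
      fderiv_mem_TS (N := fun y => (ψ y).base) hb v
    ext i
    rw [← re_conj_dotC_isoVec (ψ z).base ⟨e, he⟩ ht i, hw, dotC_smul, hds]
    simp
  · ext t i
    -- A matrix entry of the embedding as a function of the coordinates `(u, ζ)`; the chain rule
    -- then kills its derivative along `v`.
    let F : ℂ × ℂ → ℝ := fun p => (16 / (1 + conj p.1 * p.1) ^ 4 *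
      (conj p.2 * dotC t (nullVec κ p.1) * nullVec κ p.1 i)).re
    have hF : DifferentiableAt ℝ F (coordU κ ψ z, coordZ κ ψ z) := by
      have hn : (1 + conj (coordU κ ψ z) * coordU κ ψ z) ^ 4 ≠ 0 := by
        rw [← Complex.normSq_eq_conj_mul_self]
        have : 0 < 1 + Complex.normSq (coordU κ ψ z) := by
          linarith [Complex.normSq_nonneg (coordU κ ψ z)]
        exact pow_ne_zero 4 (by exact_mod_cast this.ne')
      have hN : ∀ i, DifferentiableAt ℝ (fun p : ℂ × ℂ => nullVec κ p.1 i)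
          (coordU κ ψ z, coordZ κ ψ z) := fun i =>
        (contDiffAt_nullVec κ contDiffAt_fst i).differentiableAt (by simp)
      have hdot : DifferentiableAt ℝ (fun p : ℂ × ℂ => dotC t (nullVec κ p.1))
          (coordU κ ψ z, coordZ κ ψ z) := by
        have h0 := hN 0
        have h1 := hN 1
        have h2 := hN 2
        unfold dotC
        fun_prop
      have hinv : DifferentiableAt ℝ (fun p : ℂ × ℂ => ((1 + conj p.1 * p.1) ^ 4)⁻¹)
          (coordU κ ψ z, coordZ κ ψ z) := by
        refine DifferentiableAt.inv ?_ hn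
        fun_prop
      have hconj : DifferentiableAt ℝ (fun p : ℂ × ℂ => conj p.2)
          (coordU κ ψ z, coordZ κ ψ z) := by
        fun_prop
      have hG : DifferentiableAt ℝ (fun p : ℂ × ℂ => 16 / (1 + conj p.1 * p.1) ^ 4 *
          (conj p.2 * dotC t (nullVec κ p.1) * nullVec κ p.1 i))
          (coordU κ ψ z, coordZ κ ψ z) := by
        simp only [div_eq_mul_inv]
        exact (hinv.const_mul 16).mul ((hconj.mul hdot).mul (hN i))
      exact (Complex.reCLM.hasFDerivAt.comp _ hG.hasFDerivAt).differentiableAt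
    have h1 : (fun y => (embed (ψ y)).2 t i) =ᶠ[nhds z] fun y => F (coordU κ ψ y, coordZ κ ψ y) := by
      filter_upwards [hev] with y hy
      rw [embed_snd_eq hκ (ψ y) hy, Complex.normSq_eq_conj_mul_self]
      rfl
    have h2 : HasFDerivAt (fun y => (embed (ψ y)).2 t i) ((EuclideanSpace.proj i : E3 →L[ℝ] ℝ) ∘L
        ((ContinuousLinearMap.snd ℝ E3 (E3 →L[ℝ] E3) ∘L fderiv ℝ (embed ∘ ψ) z).flip t)) z := by
      refine (EuclideanSpace.proj i : E3 →L[ℝ] ℝ).hasFDerivAt.comp z ?_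
      have := hφ.snd.clm_apply (hasFDerivAt_const t z)
      simpa using this
    have hU := ((contDiffAt_coordU hψ hd).differentiableAt (by simp)).hasFDerivAt
    have hZ := ((contDiffAt_coordZ hψ hd).differentiableAt (by simp)).hasFDerivAt
    have h3 := HasFDerivAt.comp (g := F) z hF.hasFDerivAt (hU.prodMk hZ)
    have h4 := DFunLike.congr_fun (h2.unique (h3.congr_of_eventuallyEq h1)) v
    simp [hu, hz] at h4
    rw [h4]
    exact map_zero (fderiv ℝ F _)

end

lemma differentiableAt_complex_of_real {g : ℂ → ℂ} {z : ℂ} (hg : DifferentiableAt ℝ g z)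
    (h : ∀ b, fderiv ℝ g z b = b * fderiv ℝ g z 1) : DifferentiableAt ℂ g z := by
  rw [differentiableAt_iff_restrictScalars ℝ hg]
  refine ⟨ContinuousLinearMap.toSpanSingleton ℂ (fderiv ℝ g z 1), ?_⟩
  ext1 b
  simp [h b]

/-- If `du` is invertible and `du ∧ dζ = 0`, then `u` can be used as a local coordinate, and `ζ` is
a holomorphic function of `u`. -/
lemma exists_holomorphic_coordinate {u ζ : ℂ → ℂ} {O : Set ℂ} (hO : IsOpen O)
    (hu : ∀ y ∈ O, ContDiffAt ℝ ∞ u y) (hζ : ∀ y ∈ O, ContDiffAt ℝ ∞ ζ y)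
    (hw : ∀ y ∈ O, WedgeZero u ζ y) {z : ℂ} (hz : z ∈ O)
    (hinj : Function.Injective (fderiv ℝ u z)) :
    ∃ f : OpenPartialHomeomorph ℂ ℂ, z ∈ f.source ∧ f.source ⊆ O ∧ (∀ y, f y = u y) ∧
      ContDiffOn ℝ ∞ f f.source ∧ ContDiffOn ℝ ∞ f.symm f.target ∧
      DifferentiableOn ℂ (ζ ∘ f.symm) f.target := by
  let L : ℂ ≃L[ℝ] ℂ := (LinearEquiv.ofInjectiveEndo (fderiv ℝ u z).toLinearMap
    hinj).toContinuousLinearEquiv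
  have hL : HasFDerivAt u (L : ℂ →L[ℝ] ℂ) z := by
    have : (L : ℂ →L[ℝ] ℂ) = fderiv ℝ u z := by ext1 v; rfl
    rw [this]
    exact ((hu z hz).differentiableAt (by simp)).hasFDerivAt
  let f0 := (hu z hz).toOpenPartialHomeomorph u hL (by simp)
  -- Restricting to points where `du` is invertible makes the local inverse smooth on its whole
  -- target.
  let S : Set ℂ := {y | y ∈ O ∧ fderiv ℝ u y ∈ Set.range ((↑) : (ℂ ≃L[ℝ] ℂ) → ℂ →L[ℝ] ℂ)}
  have hc : ContinuousOn (fderiv ℝ u) O := fun y hy =>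
    ((hu y hy).fderiv_right (m := 0) (by simp)).continuousAt.continuousWithinAt
  have hS : IsOpen S := hc.isOpen_inter_preimage hO ContinuousLinearEquiv.isOpen
  have hzS : z ∈ S := ⟨hz, L, hL.fderiv.symm⟩
  let f := f0.restrOpen S hS
  have hfu : ∀ y, f y = u y := fun y => rfl
  have hfs : ∀ y ∈ f.source, y ∈ S := fun y hy => hy.2
  have hsymm : ∀ y ∈ f.target, ContDiffAt ℝ ∞ f.symm y := by
    intro y hy
    have h1 := hfs _ (f.map_target hy)
    obtain ⟨h2, L', hL'⟩ := h1
    refine f.contDiffAt_symm hy (f₀' := L') ?_ (hu _ h2)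
    rw [hL']
    exact ((hu _ h2).differentiableAt (by simp)).hasFDerivAt
  refine ⟨f, ⟨(hu z hz).mem_toOpenPartialHomeomorph_source hL (by simp), hzS⟩,
    fun y hy => (hfs y hy).1, hfu, fun y hy => (hu y (hfs y hy).1).contDiffWithinAt,
    fun y hy => (hsymm y hy).contDiffWithinAt, fun y hy => ?_⟩
  obtain ⟨h2, L', hL'⟩ := hfs _ (f.map_target hy)
  have hζd := (hζ _ h2).differentiableAt (by simp)
  have hg : DifferentiableAt ℝ (ζ ∘ f.symm) y :=
    DifferentiableAt.comp y hζd ((hsymm y hy).differentiableAt (by simp))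
  refine (differentiableAt_complex_of_real hg fun b => ?_).differentiableWithinAt
  have hcomp : ∀ v, fderiv ℝ ζ (f.symm y) v =
      fderiv ℝ (ζ ∘ f.symm) y (fderiv ℝ u (f.symm y) v) := by
    intro v
    have h3 : HasFDerivAt (ζ ∘ f.symm) (fderiv ℝ (ζ ∘ f.symm) y) (u (f.symm y)) := by
      have : u (f.symm y) = y := f.right_inv hy
      rw [this]
      exact hg.hasFDerivAt
    have h4 := h3.comp (f.symm y) ((hu _ h2).differentiableAt (by simp)).hasFDerivAt
    have h5 : ζ =ᶠ[nhds (f.symm y)] (ζ ∘ f.symm) ∘ u := by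
      filter_upwards [f.open_source.mem_nhds (f.map_target hy)] with x hx
      exact (congrArg ζ (f.left_inv hx)).symm
    rw [(h4.congr_of_eventuallyEq h5).fderiv]
    rfl
  -- Evaluating `du ∧ dζ = 0` on vectors with `du(v) = b` and `du(w) = 1` gives the Cauchy–Riemann
  -- equation for `ζ ∘ u⁻¹`.
  obtain ⟨v, hv⟩ := L'.surjective b
  obtain ⟨w, hw1⟩ := L'.surjective 1
  have hv' : fderiv ℝ u (f.symm y) v = b := by rw [← hL']; exact hv
  have hw' : fderiv ℝ u (f.symm y) w = 1 := by rw [← hL']; exact hw1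
  have := hw _ h2 w v
  rw [hcomp, hcomp, hv', hw', one_mul] at this
  exact this

/-! ### Complex curves in `Q` -/

lemma assocChart_mem_atlas {κ : ℂ} (hκ : κ ^ 2 = -1) : assocChart hκ ∈ atlas (ℂ × ℂ) Assoc := by
  rcases eq_I_or_eq_neg_I hκ with rfl | rfl
  · exact Or.inr rfl
  · exact Or.inl rfl

/-- The denominators for `κ = i` and `κ = -i` add up to `2`, so they cannot both vanish. -/
lemma exists_stereoDen_ne_zero (s : E3) : ∃ κ : ℂ, κ ^ 2 = -1 ∧ stereoDen κ s ≠ 0 := by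
  by_cases h : stereoDen Complex.I s = 0
  · refine ⟨-Complex.I, by simp, fun h' => ?_⟩
    rw [stereoDen] at h h'
    have : (2 : ℂ) = 0 := by linear_combination h + h'
    norm_num at this
  · exact ⟨Complex.I, Complex.I_sq, h⟩

section

variable {κ : ℂ} {ψ : ℂ → Q}

lemma mdifferentiableAt_toAssoc (hκ : κ ^ 2 = -1) {y : ℂ}
    (hd : ∀ᶠ x in nhds y, stereoDen κ (ψ x).base ≠ 0) (hu : DifferentiableAt ℂ (coordU κ ψ) y)
    (hz : DifferentiableAt ℂ (coordZ κ ψ) y) :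
    MDifferentiableAt 𝓘(ℂ, ℂ) 𝓘(ℂ, ℂ × ℂ) (toAssoc ∘ ψ) y := by
  have h1 : MDifferentiableAt 𝓘(ℂ, ℂ) 𝓘(ℂ, ℂ × ℂ)
      (fun x => (coordU κ ψ x, coordZ κ ψ x)) y := (hu.prodMk hz).mdifferentiableAt
  have h2 := mdifferentiableAt_atlas_symm (I := 𝓘(ℂ, ℂ × ℂ)) (assocChart_mem_atlas hκ)
    (x := (coordU κ ψ y, coordZ κ ψ y)) trivial
  refine (h2.comp y h1).congr_of_eventuallyEq ?_
  filter_upwards [hd] with x hx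
  have h3 := (assocChart hκ).left_inv (x := toAssoc (ψ x)) ((mem_chartDom_iff hκ (ψ x)).2 hx)
  have h4 : assocChart hκ (toAssoc (ψ x)) = (coordU κ ψ x, coordZ κ ψ x) :=
    chartFun_toAssoc hκ (ψ x) hx
  rw [h4] at h3
  exact h3.symm

lemma differentiableAt_coord (hκ : κ ^ 2 = -1) {y : ℂ} (hd : stereoDen κ (ψ y).base ≠ 0)
    (h : MDifferentiableAt 𝓘(ℂ, ℂ) 𝓘(ℂ, ℂ × ℂ) (toAssoc ∘ ψ) y) :
    DifferentiableAt ℂ (coordU κ ψ) y ∧ DifferentiableAt ℂ (coordZ κ ψ) y := by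
  have hy : toAssoc (ψ y) ∈ (assocChart hκ).source := (mem_chartDom_iff hκ (ψ y)).2 hd
  have h2 := mdifferentiableAt_atlas (I := 𝓘(ℂ, ℂ × ℂ)) (assocChart_mem_atlas hκ) hy
  have h3 := (h2.comp y h).differentiableAt
  have h4 : (fun x => (coordU κ ψ x, coordZ κ ψ x)) =ᶠ[nhds y]
      (assocChart hκ) ∘ toAssoc ∘ ψ := by
    filter_upwards [h.continuousAt.preimage_mem_nhds
      ((assocChart hκ).open_source.mem_nhds hy)] with x hx
    exact (chartFun_toAssoc hκ (ψ x) ((mem_chartDom_iff hκ (ψ x)).1 hx)).symm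
  have h5 := h3.congr_of_eventuallyEq h4
  exact ⟨h5.fst, h5.snd⟩

end

/-! ### Closedness of `ω` and complex curves on abstract surfaces -/

section

variable {C : Type*} [TopologicalSpace C] [ChartedSpace ℂ C]
  {F : Type*} [NormedAddCommGroup F] [NormedSpace ℝ F]

lemma contDiffAt_comp_symm {f : C → F} (hf : ContMDiff 𝓘(ℝ, ℂ) 𝓘(ℝ, F) ∞ f)
    {e : OpenPartialHomeomorph C ℂ} (he : e ∈ IsManifold.maximalAtlas 𝓘(ℝ, ℂ) ∞ C) {y : ℂ}
    (hy : y ∈ e.target) : ContDiffAt ℝ ∞ (f ∘ e.symm) y :=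
  (hf.contMDiffAt.comp y (contMDiffAt_symm_of_mem_maximalAtlas he hy)).contDiffAt

/-- The part of a chart domain on which the chart of `Q` belonging to `κ` is defined. -/
def goodSet (κ : ℂ) (c : C → Q) (e : OpenPartialHomeomorph C ℂ) : Set ℂ :=
  {y | y ∈ e.target ∧ stereoDen κ (c (e.symm y)).base ≠ 0}

lemma isOpen_goodSet (κ : ℂ) {c : C → Q} (hc : ContMDiff 𝓘(ℝ, ℂ) 𝓘(ℝ, Amb) ∞ (embed ∘ c))
    {e : OpenPartialHomeomorph C ℂ} (he : e ∈ IsManifold.maximalAtlas 𝓘(ℝ, ℂ) ∞ C) :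
    IsOpen (goodSet κ c e) := by
  have h : ContinuousOn (fun y => stereoDen κ (c (e.symm y)).base) e.target := fun y hy =>
    ((contDiff_stereoDen κ).continuous.continuousAt.comp
      (contDiffAt_base (ψ := c ∘ e.symm)
        (contDiffAt_comp_symm hc he hy)).continuousAt).continuousWithinAt
  exact h.isOpen_inter_preimage e.open_target (isOpen_compl_singleton (x := 0))

variable [IsManifold 𝓘(ℝ, ℂ) ∞ C]

lemma mfderiv_eq_fderiv_chart {f : C → F} {e : OpenPartialHomeomorph C ℂ} (he : e ∈ atlas ℂ C)
    {x : C} (hx : x ∈ e.source) (hf : DifferentiableAt ℝ (f ∘ e.symm) (e x)) (v : ℂ) :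
    mfderiv 𝓘(ℝ, ℂ) 𝓘(ℝ, F) f x v =
      fderiv ℝ (f ∘ e.symm) (e x) (mfderiv 𝓘(ℝ, ℂ) 𝓘(ℝ, ℂ) e x v) := by
  have : IsManifold 𝓘(ℝ, ℂ) 1 C := IsManifold.of_le (n := ∞) ENat.LEInfty.out
  have h1 : f =ᶠ[nhds x] (f ∘ e.symm) ∘ e := by
    filter_upwards [e.open_source.mem_nhds hx] with y hy
    exact (congrArg f (e.left_inv hy)).symm
  have h2 := mdifferentiableAt_atlas (I := 𝓘(ℝ, ℂ)) he hx
  rw [h1.mfderiv_eq, mfderiv_comp x hf.mdifferentiableAt h2, mfderiv_eq_fderiv]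
  rfl

lemma mfderiv_chart_bijective {e : OpenPartialHomeomorph C ℂ} (he : e ∈ atlas ℂ C)
    {x : C} (hx : x ∈ e.source) :
    Function.Bijective (mfderiv 𝓘(ℝ, ℂ) 𝓘(ℝ, ℂ) e x) := by
  have : IsManifold 𝓘(ℝ, ℂ) 1 C := IsManifold.of_le (n := ∞) ENat.LEInfty.out
  exact (mdifferentiable_of_mem_atlas he).mfderiv_bijective hx

lemma trans_mem_maximalAtlas {e : OpenPartialHomeomorph C ℂ}
    (he : e ∈ IsManifold.maximalAtlas 𝓘(ℝ, ℂ) ∞ C) {f : OpenPartialHomeomorph ℂ ℂ}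
    (h1 : ContDiffOn ℝ ∞ f f.source) (h2 : ContDiffOn ℝ ∞ f.symm f.target) :
    e ≫ₕ f ∈ IsManifold.maximalAtlas 𝓘(ℝ, ℂ) ∞ C := by
  refine OpenPartialHomeomorph.mem_maximalAtlas_of_contMDiffOn (I := 𝓘(ℝ, ℂ)) (n := ∞) _ ?_ ?_
  · exact h1.contMDiffOn.comp ((contMDiffOn_of_mem_maximalAtlas he).mono fun x hx => hx.1)
      fun x hx => hx.2
  · exact (contMDiffOn_symm_of_mem_maximalAtlas he).comp
      (h2.contMDiffOn.mono fun x hx => hx.1) fun x hx => hx.2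

lemma isComplexCurve_of_omegaClosedOn {c : C → Q} (hc : IsImmersedSurface c)
    (h : OmegaClosedOn c) : IsComplexCurve c := by
  intro p
  obtain ⟨κ, hκ, hp⟩ := exists_stereoDen_ne_zero (c p).base
  set e := chartAt ℂ p with he_def
  have hea : e ∈ atlas ℂ C := chart_mem_atlas ℂ p
  have he : e ∈ IsManifold.maximalAtlas 𝓘(ℝ, ℂ) ∞ C := IsManifold.subset_maximalAtlas hea
  have hps : p ∈ e.source := mem_chart_source ℂ p
  have hO := isOpen_goodSet κ hc.smooth he
  have hpO : e p ∈ goodSet κ c e := ⟨e.map_source hps, by rwa [e.left_inv hps]⟩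
  have hψ : ∀ y ∈ goodSet κ c e, ContDiffAt ℝ ∞ (embed ∘ (c ∘ e.symm)) y := fun y hy =>
    contDiffAt_comp_symm hc.smooth he hy.1
  have hd : ∀ y ∈ goodSet κ c e, stereoDen κ ((c ∘ e.symm) y).base ≠ 0 := fun y hy => hy.2
  have hU := fun y hy => contDiffAt_coordU (hψ y hy) (hd y hy)
  have hZ := fun y hy => contDiffAt_coordZ (hψ y hy) (hd y hy)
  have hw : ∀ y ∈ goodSet κ c e, WedgeZero (coordU κ (c ∘ e.symm)) (coordZ κ (c ∘ e.symm)) y := by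
    refine wedgeZero_of_forall_ne_zero hO hψ hd fun y hy h0 => ?_
    rw [← extDeriv_omega_eq_zero_iff hκ hO hψ hd hy h0]
    exact h e hea y hy.1 fun h' => h0 ((op_eq_zero_iff_fibC hκ _ (hd y hy)).1 h')
  -- The immersion stays an immersion in coordinates: `du` and `dζ` have no common kernel.
  have hinj : ∀ v, fderiv ℝ (coordU κ (c ∘ e.symm)) (e p) v = 0 →
      fderiv ℝ (coordZ κ (c ∘ e.symm)) (e p) v = 0 → v = 0 := by
    intro v hv1 hv2
    have h1 := fderiv_embed_eq_zero hκ (hψ _ hpO) (hd _ hpO) hv1 hv2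
    obtain ⟨w, rfl⟩ := (mfderiv_chart_bijective hea hps).2 v
    have h2 := mfderiv_eq_fderiv_chart hea hps (f := embed ∘ c)
      ((hψ _ hpO).differentiableAt (by simp)) w
    have h3 : w = 0 := hc.immersive p ((h2.trans h1).trans (map_zero _).symm)
    rw [h3]
    exact map_zero _
  have fin : ∀ f : OpenPartialHomeomorph ℂ ℂ, e p ∈ f.source → f.source ⊆ goodSet κ c e →
      ContDiffOn ℝ ∞ f f.source → ContDiffOn ℝ ∞ f.symm f.target →
      DifferentiableOn ℂ (coordU κ (c ∘ e.symm) ∘ f.symm) f.target →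
      DifferentiableOn ℂ (coordZ κ (c ∘ e.symm) ∘ f.symm) f.target →
      ∃ e ∈ IsManifold.maximalAtlas 𝓘(ℝ, ℂ) ∞ C, p ∈ e.source ∧
        MDifferentiableOn 𝓘(ℂ, ℂ) 𝓘(ℂ, ℂ × ℂ) (toAssoc ∘ c ∘ e.symm) e.target := by
    intro f hf1 hf2 hf3 hf4 hf5 hf6
    refine ⟨e ≫ₕ f, trans_mem_maximalAtlas he hf3 hf4, ⟨hps, hf1⟩, fun y hy => ?_⟩
    have hyt : f.target ∈ nhds y := f.open_target.mem_nhds hy.1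
    refine (mdifferentiableAt_toAssoc (ψ := c ∘ e.symm ∘ f.symm) hκ ?_
      (hf5.differentiableAt hyt) (hf6.differentiableAt hyt)).mdifferentiableWithinAt
    filter_upwards [hyt] with x hx
    exact (hf2 (f.map_target hx)).2
  -- Whichever of `u` and `ζ` has injective differential at `e p` becomes the complex coordinate. If
  -- `du(v) = 0` with `v ≠ 0`, then `dζ(v) ≠ 0`, and the wedge condition gives `du = 0`, so `dζ` is
  -- injective.
  by_cases hcase : Function.Injective (fderiv ℝ (coordU κ (c ∘ e.symm)) (e p))
  · obtain ⟨f, h1, h2, h3, h4, h5, h6⟩ :=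
      exists_holomorphic_coordinate hO hU hZ hw hpO hcase
    refine fin f h1 h2 h4 h5 (differentiableOn_id.congr fun y hy => ?_) h6
    rw [Function.comp_apply, ← h3]
    exact f.right_inv hy
  · have hcase' : Function.Injective (fderiv ℝ (coordZ κ (c ∘ e.symm)) (e p)) := by
      rw [injective_iff_map_eq_zero] at hcase ⊢
      push Not at hcase
      obtain ⟨v, hv, hv0⟩ := hcase
      intro w hw0
      refine hinj w ?_ hw0
      have h1 := hw _ hpO v w
      rw [hv, zero_mul, eq_comm, mul_eq_zero] at h1
      exact h1.resolve_right fun h2 => hv0 (hinj v hv h2)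
    obtain ⟨f, h1, h2, h3, h4, h5, h6⟩ :=
      exists_holomorphic_coordinate hO hZ hU (fun y hy => (hw y hy).symm) hpO hcase'
    refine fin f h1 h2 h4 h5 h6 (differentiableOn_id.congr fun y hy => ?_)
    rw [Function.comp_apply, ← h3]
    exact f.right_inv hy

/-- With `τ` the transition to a complex coordinate, holomorphy gives `du = a dτ` and `dζ = b dτ`,
so `dζ ∧ du = ab dτ ∧ dτ = 0`. -/
lemma omegaClosedOn_of_isComplexCurve {c : C → Q} (hc : IsImmersedSurface c)
    (h : IsComplexCurve c) : OmegaClosedOn c := by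
  intro e hea z hz h0
  have he : e ∈ IsManifold.maximalAtlas 𝓘(ℝ, ℂ) ∞ C := IsManifold.subset_maximalAtlas hea
  obtain ⟨κ, hκ, hp⟩ := exists_stereoDen_ne_zero (c (e.symm z)).base
  have hO := isOpen_goodSet κ hc.smooth he
  have hzO : z ∈ goodSet κ c e := ⟨hz, hp⟩
  have hψ : ∀ y ∈ goodSet κ c e, ContDiffAt ℝ ∞ (embed ∘ (c ∘ e.symm)) y := fun y hy =>
    contDiffAt_comp_symm hc.smooth he hy.1
  have hd : ∀ y ∈ goodSet κ c e, stereoDen κ ((c ∘ e.symm) y).base ≠ 0 := fun y hy => hy.2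
  refine (extDeriv_omega_eq_zero_iff hκ hO hψ hd hzO
    fun h' => h0 ((op_eq_zero_iff_fibC hκ _ (hd z hzO)).2 h')).2 ?_
  obtain ⟨e', he', hps, hhol⟩ := h (e.symm z)
  have hτ : DifferentiableAt ℝ (e' ∘ e.symm) z :=
    ((contMDiffAt_of_mem_maximalAtlas he' hps).comp z
      (contMDiffAt_symm_of_mem_maximalAtlas he hz)).contDiffAt.differentiableAt (by simp)
  have hy := e'.map_source hps
  obtain ⟨h1, h2⟩ := differentiableAt_coord (ψ := c ∘ e'.symm) hκ
    (y := e' (e.symm z)) (by rwa [Function.comp_apply, e'.left_inv hps])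
    ((hhol _ hy).mdifferentiableAt (e'.open_target.mem_nhds hy))
  have hev : ∀ᶠ y in nhds z, e'.symm (e' (e.symm y)) = e.symm y := by
    filter_upwards [(e.continuousAt_symm hz).preimage_mem_nhds
      (e'.open_source.mem_nhds hps)] with y hy
    exact e'.left_inv hy
  have key : ∀ G : Q → ℂ, DifferentiableAt ℂ (fun y => G (c (e'.symm y))) (e' (e.symm z)) →
      ∃ a : ℂ, ∀ v, fderiv ℝ (fun y => G (c (e.symm y))) z v =
        a * fderiv ℝ (e' ∘ e.symm) z v := by
    intro G hG
    refine ⟨deriv (fun y => G (c (e'.symm y))) (e' (e.symm z)), fun v => ?_⟩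
    have h3 := HasFDerivAt.comp (f := e' ∘ e.symm) z hG.hasDerivAt.complexToReal_fderiv
      hτ.hasFDerivAt
    have h4 : (fun y => G (c (e.symm y))) =ᶠ[nhds z]
        (fun y => G (c (e'.symm y))) ∘ (e' ∘ e.symm) := by
      filter_upwards [hev] with y hy
      simp [hy]
    rw [(h3.congr_of_eventuallyEq h4).fderiv]
    simp
  obtain ⟨a, ha⟩ := key (fun q => stereo κ q.base) h1
  obtain ⟨b, hb⟩ := key (fun q => fibC κ (embed q)) h2
  intro v w
  have ha' : ∀ v, fderiv ℝ (coordU κ (c ∘ e.symm)) z v = a * fderiv ℝ (e' ∘ e.symm) z v := ha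
  have hb' : ∀ v, fderiv ℝ (coordZ κ (c ∘ e.symm)) z v = b * fderiv ℝ (e' ∘ e.symm) z v := hb
  rw [ha', ha', hb', hb']
  ring

end

/-! ### Holomorphic data of minimal surfaces -/

lemma re_conj_dotC_nullVec {κ : ℂ} (hκ : κ ^ 2 = -1) (q : Q) (hs : stereoDen κ q.base ≠ 0) {t : E3}
    (ht : t ∈ TS q.base) (i : Fin 3) :
    t i = (4 / (1 + Complex.normSq (stereo κ q.base)) ^ 2 *
      conj (dotC t (nullVec κ (stereo κ q.base))) * nullVec κ (stereo κ q.base) i).re := by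
  obtain ⟨v, hv⟩ := exists_unit q.base
  obtain ⟨d, hd, hw, hn, h, -⟩ := exists_den hκ q hs ⟨v, hv⟩
  have hn2 : conj d * d = 4 / (1 + Complex.normSq (stereo κ q.base)) ^ 2 := by
    rw [← Complex.normSq_eq_conj_mul_self, hn]
    push_cast
    rfl
  rw [← hn2, ← re_conj_dotC_isoVec q.base ⟨v, hv⟩ ht i, hw, dotC_smul]
  congr 1
  simp
  ring

/-- The zero element of the fibre over `s`. -/
def zeroQ (s : S2) : Q := ⟨s, 0, by intro x y; simp, by simp⟩

lemma contDiffAt_sigma_nullVec {κ : ℂ} (hκ : κ ^ 2 = -1) {u : ℂ → ℂ} {z : ℂ} (hu : ContDiffAt ℝ ∞ u z) :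
    ContDiffAt ℝ ∞ (fun y => sigma (nullVec κ (u y))) z := by
  have hN : ∀ i, ContDiffAt ℝ ∞ (fun y => nullVec κ (u y) i) z := contDiffAt_nullVec κ hu
  have hre : ∀ i, ContDiffAt ℝ ∞ (fun y => (nullVec κ (u y) i).re) z := fun i =>
    Complex.reCLM.contDiff.contDiffAt.comp z (hN i)
  have him : ∀ i, ContDiffAt ℝ ∞ (fun y => (nullVec κ (u y) i).im) z := fun i =>
    Complex.imCLM.contDiff.contDiffAt.comp z (hN i)
  have hs : ContDiffAt ℝ ∞ (fun y => ((nullVec κ (u y) 0).re ^ 2 + (nullVec κ (u y) 1).re ^ 2 +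
      (nullVec κ (u y) 2).re ^ 2)⁻¹) z := by
    refine ((((hre 0).pow 2).add ((hre 1).pow 2)).add ((hre 2).pow 2)).inv ?_
    refine (isotropic_re_im (nullVec_ne_zero κ (u z)) ?_).1
    rw [dotProduct, Fin.sum_univ_three]
    simp [nullVec]
    linear_combination (1 + u z ^ 2) ^ 2 / 4 * hκ
  rw [contDiffAt_euclidean]
  intro i
  simp only [sigma_apply]
  refine hs.mul ?_
  fin_cases i <;> simp only [cross_apply0, cross_apply1, cross_apply2, Fin.zero_eta, Fin.mk_one,
    Fin.reduceFinMk]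
  · exact ((hre 1).mul (him 2)).sub ((hre 2).mul (him 1))
  · exact ((hre 2).mul (him 0)).sub ((hre 0).mul (him 2))
  · exact ((hre 0).mul (him 1)).sub ((hre 1).mul (him 0))

/-- Locally `u = w₃ / (w₁ + κ w₂)` for the holomorphic lift `w` of the map to the quadric. -/
lemma differentiableAt_stereo {κ : ℂ} (hκ : κ ^ 2 = -1) {N : ℂ → S2} {w : ℂ → Fin 3 → ℂ} {z : ℂ}
    (hd : stereoDen κ (N z) ≠ 0) (hw : DifferentiableAt ℂ w z)
    (h : ∀ᶠ y in nhds z, w y ≠ 0 ∧ w y ⬝ᵥ w y = 0 ∧ (N y : E3) = sigma (w y)) :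
    DifferentiableAt ℂ (fun y => stereo κ (N y)) z := by
  have hnull : ∀ᶠ y in nhds z, IsNullOver (N y) (w y) := by
    filter_upwards [h] with y hy
    rw [hy.2.2]
    exact isNullOver_sigma hy.1 hy.2.1
  have hwi : ∀ i, DifferentiableAt ℂ (fun y => w y i) z := differentiableAt_pi.1 hw
  have hden : DifferentiableAt ℂ (fun y => w y 0 + κ * w y 1) z :=
    (hwi 0).add ((hwi 1).const_mul κ)
  have hz : w z 0 + κ * w z 1 ≠ 0 :=
    (hnull.self_of_nhds.den_ne_zero_iff h.self_of_nhds.1 hκ (norm_base _)).2 hd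
  refine ((hwi 2).div hden hz).congr_of_eventuallyEq ?_
  filter_upwards [hnull, h, hden.continuousAt.eventually_ne hz] with y h1 h2 h3
  exact (h1.stereo_eq hκ h3 ((h1.den_ne_zero_iff h2.1 hκ (norm_base _)).1 h3)).symm

lemma contDiffAt_of_differentiableOn {u : ℂ → ℂ} {O : Set ℂ} (hO : IsOpen O)
    (hu : ∀ y ∈ O, DifferentiableAt ℂ u y) {z : ℂ} (hz : z ∈ O) : ContDiffAt ℝ ∞ u z :=
  (((show DifferentiableOn ℂ u O from fun y hy => (hu y hy).differentiableWithinAt).contDiffOn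
    hO).contDiffAt (hO.mem_nhds hz)).restrict_scalars ℝ

/-- A holomorphic `u` is smooth, and `N = σ(w(u))`. This supplies the smoothness of the Gauss map,
which is only assumed continuous. -/
lemma contDiffAt_of_stereo {κ : ℂ} (hκ : κ ^ 2 = -1) {N : ℂ → S2} {O : Set ℂ} (hO : IsOpen O)
    (hd : ∀ y ∈ O, stereoDen κ (N y) ≠ 0)
    (hu : ∀ y ∈ O, DifferentiableAt ℂ (fun y => stereo κ (N y)) y) {z : ℂ} (hz : z ∈ O) :
    ContDiffAt ℝ ∞ (fun y => (N y : E3)) z := by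
  refine (contDiffAt_sigma_nullVec hκ
    (contDiffAt_of_differentiableOn hO hu hz)).congr_of_eventuallyEq ?_
  filter_upwards [hO.mem_nhds hz] with y hy
  exact (isNullOver_nullVec hκ (zeroQ (N y)) (hd y hy)).eq_sigma (nullVec_ne_zero κ _)

/-- If `dE = Re (g w(u) dz)` for a holomorphic function `u`, then `g` is holomorphic as well. -/
lemma differentiableAt_weierstrass {κ : ℂ} {E : ℂ → E3} {g u : ℂ → ℂ} {z : ℂ}
    (hE : ContDiffAt ℝ 2 E z) (hu : DifferentiableAt ℂ u z) (hu' : ContDiffAt ℝ ∞ u z)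
    (hg : ContDiffAt ℝ 1 g z) (hi : nullVec κ (u z) 0 ^ 2 + nullVec κ (u z) 1 ^ 2 +
      nullVec κ (u z) 2 ^ 2 = 0)
    (h : ∀ᶠ y in nhds z, ∀ v i, fderiv ℝ E y v i = (g y * v * nullVec κ (u y) i).re) :
    DifferentiableAt ℂ g z := by
  have hk : ∀ i, ContDiffAt ℝ 1 (fun y => g y * nullVec κ (u y) i) z := fun i =>
    hg.mul ((contDiffAt_nullVec κ hu' i).of_le ENat.LEInfty.out)
  have hL : ∀ᶠ y in nhds z, ∀ v i, fderiv ℝ E y v i =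
      (g y * nullVec κ (u y) i * fderiv ℝ (fun x : ℂ => x) y v).re := by
    filter_upwards [h] with y hy v i
    rw [hy, fderiv_fun_id]
    congr 1
    simp
    ring
  have hE1 : ContDiffAt ℝ 1 (fderiv ℝ E) z := hE.fderiv_right (by norm_num)
  have hdk : ∀ i v, fderiv ℝ (fun y => g y * nullVec κ (u y) i) z v =
      fderiv ℝ g z v * nullVec κ (u z) i +
        g z * (![-u z, -κ * u z, 1] i * (deriv u z * v)) := by
    intro i v
    have h1 := (hg.differentiableAt one_ne_zero).hasFDerivAt.mul
      (hasFDerivAt_nullVec (κ := κ) (hu'.differentiableAt (by simp)) i)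
    have h2 : fderiv ℝ u z v = deriv u z * v := by
      rw [hu.hasDerivAt.complexToReal_fderiv.fderiv]
      simp
    have h3 : fderiv ℝ (fun y => g y * nullVec κ (u y) i) z = _ := h1.fderiv
    rw [h3]
    simp [h2]
    ring
  refine differentiableAt_complex_of_real (hg.differentiableAt one_ne_zero) fun b => ?_
  rw [← sub_eq_zero]
  refine re_smul_eq_zero (nullVec_ne_zero κ (u z)) hi fun i => ?_
  -- Compute `d(dE) = 0` from `dE = Re (g w(u) dz)`: the terms with `u'` cancel on `(b, 1)`, leaving
  -- `Re ((dg(b) - b dg(1)) w(u)) = 0`.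
  have h1 := extDeriv_re_mul_fderiv contDiffAt_id hk hL ![b, 1] i
  rw [extDeriv_ofSubsingleton_apply (hE1.differentiableAt one_ne_zero),
    (hE.isSymmSndFDerivAt (by simp)).eq, sub_self, hdk, hdk] at h1
  simp only [Matrix.cons_val_zero, Matrix.cons_val_one] at h1
  have h2 : ∀ a : ℂ, fderiv ℝ (id : ℂ → ℂ) z a = a := by
    intro a
    rw [fderiv_id]
    rfl
  rw [h2, h2] at h1
  refine Eq.trans ?_ h1.symm
  congr 1
  ring

/-- A function `a f' / g` is holomorphic if `f` is holomorphic and if `g` is holomorphic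
where `f'` has no zeros. -/
lemma differentiableAt_deriv_div {u g ζ : ℂ → ℂ} {a : ℂ} {O : Set ℂ} (hO : IsOpen O)
    (hu : ∀ y ∈ O, DifferentiableAt ℂ u y) (hg0 : ∀ y ∈ O, g y ≠ 0)
    (hgc : ∀ y ∈ O, ContinuousAt g y) (hζ : ∀ y ∈ O, ζ y = a * deriv u y / g y)
    (hg : ∀ y ∈ O, deriv u y ≠ 0 → DifferentiableAt ℂ g y) {z : ℂ} (hz : z ∈ O) :
    DifferentiableAt ℂ ζ z := by
  have hO' : DifferentiableOn ℂ u O := fun y hy => (hu y hy).differentiableWithinAt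
  have hdiff : ∀ y ∈ O, DifferentiableAt ℂ (deriv u) y := fun y hy =>
    (hO'.deriv hO).differentiableAt (hO.mem_nhds hy)
  have hne : ∀ y ∈ O, deriv u y ≠ 0 → DifferentiableAt ℂ ζ y := by
    intro y hy h0
    refine (((hdiff y hy).const_mul a).div (hg y hy h0) (hg0 y hy)).congr_of_eventuallyEq ?_
    filter_upwards [hO.mem_nhds hy] with x hx using hζ x hx
  have han : AnalyticAt ℂ (deriv u) z := (hO'.deriv hO).analyticAt (hO.mem_nhds hz)
  -- Either `u'` vanishes near `z`, and then so does `ζ`, or `z` is at most an isolated zero of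
  -- `u'`, where continuity of `ζ` removes the singularity.
  rcases han.eventually_eq_zero_or_eventually_ne_zero with h | h
  · refine (differentiableAt_const (0 : ℂ)).congr_of_eventuallyEq ?_
    filter_upwards [h, hO.mem_nhds hz] with x hx hxO
    rw [hζ x hxO, hx, mul_zero, zero_div]
  · have hc : ContinuousAt ζ z := by
      refine ((((hdiff z hz).continuousAt).const_mul a).div (hgc z hz)
        (hg0 z hz)).congr_of_eventuallyEq ?_
      filter_upwards [hO.mem_nhds hz] with x hx using hζ x hx
    refine (Complex.analyticAt_of_differentiable_on_punctured_nhds_of_continuousAt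
      ?_ hc).differentiableAt
    filter_upwards [h, nhdsWithin_le_nhds (hO.mem_nhds hz)] with x hx hxO using hne x hxO hx

/-! ### The derivative of the Gauss map -/

section

variable {M : Type*} [TopologicalSpace M]

/-- The part of a chart domain on which the stereographic projection of the normal is defined. -/
def normalSet (κ : ℂ) (n : M → S2) (e : OpenPartialHomeomorph M ℂ) : Set ℂ :=
  {y | y ∈ e.target ∧ stereoDen κ (n (e.symm y)) ≠ 0}

lemma isOpen_normalSet (κ : ℂ) {n : M → S2} (hn : Continuous n)
    (e : OpenPartialHomeomorph M ℂ) : IsOpen (normalSet κ n e) := by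
  have h : ContinuousOn (fun y => stereoDen κ (n (e.symm y))) e.target :=
    ((contDiff_stereoDen κ).continuous.comp
      (continuous_subtype_val.comp hn)).comp_continuousOn e.continuousOn_symm
  exact h.isOpen_inter_preimage e.open_target (isOpen_compl_singleton (x := 0))

variable [ChartedSpace ℂ M]

lemma isManifold_real_of_complex [IsManifold 𝓘(ℂ, ℂ) ω M] : IsManifold 𝓘(ℝ, ℂ) ∞ M := by
  refine isManifold_of_contDiffOn _ _ _ fun e e' he he' => ?_
  have h : ContDiffOn ℂ ω (e.symm ≫ₕ e') (e.symm ≫ₕ e').source := by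
    simpa [contDiffPregroupoid] using
      (HasGroupoid.compatible (G := contDiffGroupoid ω 𝓘(ℂ, ℂ)) he he').1
  simpa using (h.restrict_scalars ℝ).of_le (m := ∞) le_top

lemma differentiableAt_stereo_normal [IsManifold 𝓘(ℂ, ℂ) ω M] {n : M → S2}
    (hn : IsHolomorphicToSphere n) {κ : ℂ} (hκ : κ ^ 2 = -1) {e : OpenPartialHomeomorph M ℂ}
    (he : e ∈ atlas ℂ M) {z : ℂ} (hz : z ∈ e.target) (hd : stereoDen κ (n (e.symm z)) ≠ 0) :
    DifferentiableAt ℂ (fun y => stereo κ (n (e.symm y))) z := by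
  have : IsManifold 𝓘(ℂ, ℂ) 1 M := IsManifold.of_le (n := ω) le_top
  obtain ⟨U, hU, hzU, w, hw, h⟩ := hn (e.symm z)
  have h1 := mdifferentiableAt_atlas_symm (I := 𝓘(ℂ, ℂ)) he hz
  have h2 := ((hw _ hzU).mdifferentiableAt (hU.mem_nhds hzU)).comp z h1
  refine differentiableAt_stereo hκ (N := fun y => n (e.symm y)) hd h2.differentiableAt ?_
  filter_upwards [(e.continuousAt_symm hz).preimage_mem_nhds (hU.mem_nhds hzU)] with y hy
    using h _ hy

lemma contDiffAt_normal [IsManifold 𝓘(ℂ, ℂ) ω M] {n : M → S2} (hnc : Continuous n)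
    (hn : IsHolomorphicToSphere n) {e : OpenPartialHomeomorph M ℂ}
    (he : e ∈ atlas ℂ M) {z : ℂ} (hz : z ∈ e.target) :
    ContDiffAt ℝ ∞ (fun y => (n (e.symm y) : E3)) z := by
  obtain ⟨κ, hκ, hd⟩ := exists_stereoDen_ne_zero (n (e.symm z))
  exact contDiffAt_of_stereo hκ (N := fun y => n (e.symm y)) (isOpen_normalSet κ hnc e)
    (fun y hy => hy.2) (fun y hy => differentiableAt_stereo_normal hn hκ he hy.1 hy.2) ⟨hz, hd⟩

variable [IsManifold 𝓘(ℝ, ℂ) ∞ M] {ε : M → E3} {n : M → S2} (hε : IsOrientedImmersion ε n)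
  {e : OpenPartialHomeomorph M ℂ} (he : e ∈ atlas ℂ M) {z : ℂ} (hz : z ∈ e.target)
include hε he hz

lemma contDiffAt_immersion : ContDiffAt ℝ ∞ (ε ∘ e.symm) z :=
  contDiffAt_comp_symm hε.smooth (IsManifold.subset_maximalAtlas he) hz

lemma mfderiv_immersion (v : ℂ) : mfderiv 𝓘(ℝ, ℂ) 𝓘(ℝ, E3) ε (e.symm z) v =
    fderiv ℝ (ε ∘ e.symm) z (mfderiv 𝓘(ℝ, ℂ) 𝓘(ℝ, ℂ) e (e.symm z) v) := by
  have h := mfderiv_eq_fderiv_chart he (e.map_target hz) (f := ε)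
    (by rw [e.right_inv hz]; exact (contDiffAt_immersion hε he hz).differentiableAt (by simp)) v
  rwa [e.right_inv hz] at h

lemma fderiv_immersion_mem (v : ℂ) : fderiv ℝ (ε ∘ e.symm) z v ∈ TS (n (e.symm z)) := by
  obtain ⟨w, rfl⟩ := (mfderiv_chart_bijective he (e.map_target hz)).2 v
  rw [mem_TS]
  exact (congrArg (fun t : E3 => ⟪(n (e.symm z) : E3), t⟫_ℝ)
    (mfderiv_immersion hε he hz w)).symm.trans (hε.normal (e.symm z) w)

lemma fderiv_immersion_injective : Function.Injective (fderiv ℝ (ε ∘ e.symm) z) := by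
  rw [injective_iff_map_eq_zero]
  intro v hv
  obtain ⟨w, rfl⟩ := (mfderiv_chart_bijective he (e.map_target hz)).2 v
  have h := mfderiv_immersion hε he hz w
  have h3 : w = 0 := hε.immersive _ ((h.trans hv).trans (map_zero _).symm)
  rw [h3]
  exact map_zero _

lemma exists_fderiv_immersion_eq (t : TS (n (e.symm z))) :
    ∃ v, fderiv ℝ (ε ∘ e.symm) z v = t := by
  let f : ℂ →ₗ[ℝ] TS (n (e.symm z)) := (fderiv ℝ (ε ∘ e.symm) z).toLinearMap.codRestrict _
    (fderiv_immersion_mem hε he hz)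
  have hf : Function.Injective f := fun a b hab =>
    fderiv_immersion_injective hε he hz (congrArg Subtype.val hab)
  have hrank : Module.finrank ℝ ℂ = Module.finrank ℝ (TS (n (e.symm z))) := by
    have : Fact (Module.finrank ℝ E3 = 2 + 1) := ⟨by simp⟩
    rw [Complex.finrank_real_complex, Submodule.finrank_orthogonal_span_singleton (n := 2)]
    intro h0
    have := norm_base (n (e.symm z))
    rw [h0, norm_zero] at this
    exact zero_ne_one this
  obtain ⟨v, hv⟩ := (LinearMap.injective_iff_surjective_of_finrank_eq_finrank hrank).1 hf t
  exact ⟨v, congrArg Subtype.val hv⟩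

variable (hN : DifferentiableAt ℝ (fun y => (n (e.symm y) : E3)) z)
include hN

/-- In a chart this is the defining relation `n' ∘ dε = dn`. The projection in `gaussDeriv` is
harmless because `dn` is tangent to the sphere. -/
lemma gaussDeriv_apply (t : TS (n (e.symm z))) {v : ℂ}
    (hv : fderiv ℝ (ε ∘ e.symm) z v = t) :
    (gaussDeriv ε n (e.symm z) t : E3) = fderiv ℝ (fun y => (n (e.symm y) : E3)) z v := by
  obtain ⟨w, rfl⟩ := (mfderiv_chart_bijective he (e.map_target hz)).2 v
  let dε : ℂ →L[ℝ] E3 := mfderiv 𝓘(ℝ, ℂ) 𝓘(ℝ, E3) ε (e.symm z)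
  let dn : ℂ →L[ℝ] E3 := mfderiv 𝓘(ℝ, ℂ) 𝓘(ℝ, E3) (fun y => (n y : E3)) (e.symm z)
  have h1 : dε w = t := (mfderiv_immersion hε he hz w).trans hv
  have hinj : Function.Injective dε := hε.immersive (e.symm z)
  have h2 : dε.toLinearMap.leftInverse (t : E3) = w := by
    rw [← h1]
    exact LinearMap.leftInverse_apply_of_inj (LinearMap.ker_eq_bot.2 hinj) w
  have h3 : dn w = fderiv ℝ (fun y => (n (e.symm y) : E3)) z
      (mfderiv 𝓘(ℝ, ℂ) 𝓘(ℝ, ℂ) e (e.symm z) w) := by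
    have h := mfderiv_eq_fderiv_chart he (e.map_target hz) (f := fun y => (n y : E3))
      (by rw [e.right_inv hz]; exact hN) w
    rw [e.right_inv hz] at h
    exact h
  have h4 : gaussDeriv ε n (e.symm z) t = (TS (n (e.symm z))).orthogonalProjectionOnto
      (dn (dε.toLinearMap.leftInverse (t : E3))) := rfl
  have hmem := fderiv_mem_TS (N := fun y => n (e.symm y)) hN
    (mfderiv 𝓘(ℝ, ℂ) 𝓘(ℝ, ℂ) e (e.symm z) w)
  rw [h4, h2, h3]
  exact congrArg Subtype.val
    (Submodule.orthogonalProjectionOnto_mem_subspace_eq_self (⟨_, hmem⟩ : TS (n (e.symm z))))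

/-- Differentiating `⟨n, dε(b)⟩ = 0` gives `⟨dn(a), dε(b)⟩ = -⟨n, d²ε(a, b)⟩`, which is symmetric in
`a` and `b`. -/
lemma inner_fderiv_symm (a b : ℂ) :
    ⟪fderiv ℝ (fun y => (n (e.symm y) : E3)) z a, fderiv ℝ (ε ∘ e.symm) z b⟫_ℝ =
      ⟪fderiv ℝ (ε ∘ e.symm) z a, fderiv ℝ (fun y => (n (e.symm y) : E3)) z b⟫_ℝ := by
  have hE : ContDiffAt ℝ 2 (ε ∘ e.symm) z := (contDiffAt_immersion hε he hz).of_le ENat.LEInfty.out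
  have hE1 : DifferentiableAt ℝ (fderiv ℝ (ε ∘ e.symm)) z :=
    (hE.fderiv_right (m := 1) (by norm_num)).differentiableAt one_ne_zero
  have key : ∀ a b, ⟪(n (e.symm z) : E3), fderiv ℝ (fderiv ℝ (ε ∘ e.symm)) z a b⟫_ℝ +
      ⟪fderiv ℝ (fun y => (n (e.symm y) : E3)) z a, fderiv ℝ (ε ∘ e.symm) z b⟫_ℝ = 0 := by
    intro a b
    have h1 : HasFDerivAt (fun y => fderiv ℝ (ε ∘ e.symm) y b)
        ((fderiv ℝ (fderiv ℝ (ε ∘ e.symm)) z).flip b) z := by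
      have := hE1.hasFDerivAt.clm_apply (hasFDerivAt_const b z)
      simpa using this
    have h2 := hN.hasFDerivAt.inner ℝ h1
    have h3 : (fun y => ⟪(n (e.symm y) : E3), fderiv ℝ (ε ∘ e.symm) y b⟫_ℝ) =ᶠ[nhds z]
        fun _ => 0 := by
      filter_upwards [e.open_target.mem_nhds hz] with y hy
      exact mem_TS.1 (fderiv_immersion_mem hε he hy b)
    have h4 := DFunLike.congr_fun (h2.unique
      ((hasFDerivAt_const (0 : ℝ) z).congr_of_eventuallyEq h3)) a
    simpa using h4
  have h1 := key a b
  have h2 := key b a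
  rw [(hE.isSymmSndFDerivAt (by simp)).eq b a] at h2
  rw [real_inner_comm (fderiv ℝ (fun y => (n (e.symm y) : E3)) z b)]
  linarith

lemma gaussDeriv_isSymmetric_chart : (gaussDeriv ε n (e.symm z)).IsSymmetric := by
  intro s t
  obtain ⟨a, ha⟩ := exists_fderiv_immersion_eq hε he hz s
  obtain ⟨b, hb⟩ := exists_fderiv_immersion_eq hε he hz t
  rw [Submodule.coe_inner, Submodule.coe_inner, gaussDeriv_apply hε he hz hN s ha,
    gaussDeriv_apply hε he hz hN t hb, ← ha, ← hb]
  exact inner_fderiv_symm hε he hz hN a b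

end

/-! ### Holomorphy of `n'` -/

section

variable {M : Type*} [TopologicalSpace M] [ChartedSpace ℂ M] [IsManifold 𝓘(ℂ, ℂ) ω M]
  {ε : M → E3} {n : M → S2}

lemma gaussDeriv_isSymmetric (hε : IsOrientedImmersion ε n) (hn : IsHolomorphicToSphere n)
    (x : M) : (gaussDeriv ε n x).IsSymmetric := by
  have := isManifold_real_of_complex (M := M)
  have hx := mem_chart_source ℂ x
  have h := gaussDeriv_isSymmetric_chart hε (chart_mem_atlas ℂ x)
    ((chartAt ℂ x).map_source hx) ((contDiffAt_normal hε.continuous_normal hn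
      (chart_mem_atlas ℂ x) ((chartAt ℂ x).map_source hx)).differentiableAt (by simp))
  rwa [(chartAt ℂ x).left_inv hx] at h

/-- Conjugate linearity of `n'` gives `ζ g = -iκ u'`; holomorphy of `g` where `u' ≠ 0` then
suffices. The operator hypothesis compares underlying vectors in `ℝ³`, because `(f x).base` and `n
x` are only propositionally equal. -/
lemma differentiableAt_coordZ_gaussDeriv (hε : IsOrientedImmersion ε n)
    (hn : IsHolomorphicToSphere n) {f : M → Q} (hf : ∀ x, (f x).base = n x)
    (hfop : ∀ x (t : TS (n x)) (s : TS (f x).base), (t : E3) = s →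
      (gaussDeriv ε n x t : E3) = (f x).op s)
    {κ : ℂ} (hκ : κ ^ 2 = -1) {e : OpenPartialHomeomorph M ℂ} (he : e ∈ atlas ℂ M) {z : ℂ}
    (hz : z ∈ normalSet κ n e) : DifferentiableAt ℂ (coordZ κ (f ∘ e.symm)) z := by
  have := isManifold_real_of_complex (M := M)
  have hO := isOpen_normalSet κ hε.continuous_normal e
  set u : ℂ → ℂ := fun y => stereo κ (n (e.symm y)) with hu_def
  have hu : ∀ y ∈ normalSet κ n e, DifferentiableAt ℂ u y := fun y hy =>
    differentiableAt_stereo_normal hn hκ he hy.1 hy.2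
  have huc : ∀ y ∈ normalSet κ n e, ContDiffAt ℝ ∞ u y := fun y hy =>
    contDiffAt_of_differentiableOn hO hu hy
  have hN : ∀ y ∈ normalSet κ n e, DifferentiableAt ℝ (fun y => (n (e.symm y) : E3)) y :=
    fun y hy => (contDiffAt_normal hε.continuous_normal hn he hy.1).differentiableAt (by simp)
  have hE : ∀ y ∈ normalSet κ n e, ContDiffAt ℝ ∞ (ε ∘ e.symm) y := fun y hy =>
    contDiffAt_immersion hε he hy.1
  have hd : ∀ y ∈ normalSet κ n e, stereoDen κ (f (e.symm y)).base ≠ 0 := fun y hy => by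
    rw [hf]; exact hy.2
  set r : ℂ → ℂ := fun y => 4 / (1 + conj (u y) * u y) ^ 2 with hr_def
  have hr : ∀ y, r y = 4 / (1 + (Complex.normSq (u y) : ℂ)) ^ 2 := fun y => by
    rw [hr_def, Complex.normSq_eq_conj_mul_self]
  have hden : ∀ y, 1 + (Complex.normSq (u y) : ℂ) ≠ 0 := fun y => by
    have : 0 < 1 + Complex.normSq (u y) := by linarith [Complex.normSq_nonneg (u y)]
    exact_mod_cast this.ne'
  have hr0 : ∀ y, r y ≠ 0 := fun y => by
    rw [hr]
    exact div_ne_zero (by norm_num) (pow_ne_zero 2 (hden y))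
  -- The only possible coefficient in `dε = Re (g w(u) dz)`, read off from the direction `1`; the
  -- immersion property makes it nonzero.
  set g : ℂ → ℂ := fun y =>
    r y * conj (dotC (fderiv ℝ (ε ∘ e.symm) y 1) (nullVec κ (u y))) with hg_def
  have hgc : ∀ y ∈ normalSet κ n e, ContDiffAt ℝ 1 g y := by
    intro y hy
    have hconj : ∀ {a : ℂ → ℂ}, ContDiffAt ℝ 1 a y → ContDiffAt ℝ 1 (fun x => conj (a x)) y :=
      fun ha => ContDiffAt.comp (g := Complex.conjCLE) y Complex.conjCLE.contDiff.contDiffAt ha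
    have hu1 : ContDiffAt ℝ 1 u y := (huc y hy).of_le ENat.LEInfty.out
    have hE1 : ContDiffAt ℝ 1 (fun x => fderiv ℝ (ε ∘ e.symm) x 1) y :=
      (((hE y hy).of_le (m := 2) ENat.LEInfty.out).fderiv_right (m := 1)
        (by norm_num)).clm_apply contDiffAt_const
    have hterm : ∀ i : Fin 3, ContDiffAt ℝ 1
        (fun x => (fderiv ℝ (ε ∘ e.symm) x 1 i : ℂ) * nullVec κ (u x) i) y := fun i =>
      (((contDiff_ofReal_coord i).of_le ENat.LEInfty.out).contDiffAt.comp y hE1).mul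
        ((contDiffAt_nullVec κ (huc y hy) i).of_le ENat.LEInfty.out)
    have hinv : ContDiffAt ℝ 1 (fun x => ((1 + conj (u x) * u x) ^ 2)⁻¹) y := by
      refine ((contDiffAt_const.add ((hconj hu1).mul hu1)).pow 2).inv ?_
      rw [← Complex.normSq_eq_conj_mul_self]
      exact pow_ne_zero 2 (hden y)
    simp only [hg_def, hr_def, div_eq_mul_inv]
    exact (contDiffAt_const.mul hinv).mul (hconj (((hterm 0).add (hterm 1)).add (hterm 2)))
  have hmem : ∀ y ∈ normalSet κ n e, ∀ v, fderiv ℝ (ε ∘ e.symm) y v ∈ TS (f (e.symm y)).base := by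
    intro y hy v
    rw [hf]
    exact fderiv_immersion_mem hε he hy.1 v
  have hrec : ∀ y ∈ normalSet κ n e, ∀ v i, fderiv ℝ (ε ∘ e.symm) y v i =
      (r y * conj (dotC (fderiv ℝ (ε ∘ e.symm) y v) (nullVec κ (u y))) *
        nullVec κ (u y) i).re := by
    intro y hy v i
    have h := re_conj_dotC_nullVec hκ (f (e.symm y)) (hd y hy) (hmem y hy v) i
    simp only [hf] at h
    rw [hr]
    exact h
  have hg0 : ∀ y ∈ normalSet κ n e, g y ≠ 0 := by
    intro y hy h0
    have h1 : fderiv ℝ (ε ∘ e.symm) y 1 = 0 := by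
      ext i
      rw [hrec y hy]
      change (g y * _).re = _
      rw [h0]
      simp
    exact one_ne_zero (fderiv_immersion_injective hε he hy.1 (h1.trans (map_zero _).symm))
  -- Two expressions for `dn(v) · w(u)`: it is `r ζ` times the conjugate of `dε(v) · w(u)` by `dn =
  -- n' ∘ dε`, and `-iκ u' v` by the holomorphy of `u`.
  have hmain : ∀ y ∈ normalSet κ n e, ∀ v, r y * coordZ κ (f ∘ e.symm) y *
      conj (dotC (fderiv ℝ (ε ∘ e.symm) y v) (nullVec κ (u y))) =
        -(Complex.I * κ) * deriv u y * v := by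
    intro y hy v
    have h1 := dotC_op_nullVec hκ (f (e.symm y)) (hd y hy) ⟨_, hmem y hy v⟩
    have h2 := gaussDeriv_apply hε he hy.1 (hN y hy)
      ⟨_, fderiv_immersion_mem hε he hy.1 v⟩ (v := v) rfl
    rw [hfop _ _ ⟨_, hmem y hy v⟩ rfl] at h2
    have h3 := dotC_fderiv_base hκ (ψ := fun y => zeroQ (n (e.symm y))) (hN y hy) hy.2 v
    have h4 : fderiv ℝ u y v = deriv u y * v := by
      rw [(hu y hy).hasDerivAt.complexToReal_fderiv.fderiv]
      simp
    have h5 : dotC (fderiv ℝ (fun y => (n (e.symm y) : E3)) y v) (nullVec κ (u y)) =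
      -(Complex.I * κ) * fderiv ℝ u y v := h3
    rw [h2] at h1
    simp only [hf] at h1
    rw [h4] at h5
    rw [mul_assoc (-(Complex.I * κ)), ← h5, hr]
    exact h1.symm
  refine differentiableAt_deriv_div (u := u) (g := g) (a := -(Complex.I * κ)) hO hu hg0
    (fun y hy => (hgc y hy).continuousAt) (fun y hy => ?_) (fun y hy h0 => ?_) hz
  · rw [eq_div_iff (hg0 y hy)]
    have := hmain y hy 1
    rw [mul_one] at this
    rw [← this, hg_def]
    ring
  · have hdc : ContinuousAt (deriv u) y := by
      have hO' : DifferentiableOn ℂ u (normalSet κ n e) := fun y hy =>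
        (hu y hy).differentiableWithinAt
      exact ((hO'.deriv hO).differentiableAt (hO.mem_nhds hy)).continuousAt
    refine differentiableAt_weierstrass (κ := κ) (E := ε ∘ e.symm)
      ((hE y hy).of_le ENat.LEInfty.out) (hu y hy) (huc y hy) (hgc y hy)
      (isNullOver_nullVec hκ (zeroQ (n (e.symm y))) hy.2).isotropic ?_
    -- Where `u' ≠ 0` also `ζ ≠ 0`. Comparing `hmain` for `v` and for `1` and cancelling `ζ` shows
    -- that `r` times the conjugate of `dε(v) · w(u)` equals `g v`, which is conformality.
    filter_upwards [hO.mem_nhds hy, hdc.eventually_ne h0] with x hx hx0 v i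
    have h1 := hmain x hx v
    have h2 := hmain x hx 1
    have hI := I_mul_ne_zero hκ
    have hζ : coordZ κ (f ∘ e.symm) x ≠ 0 := by
      intro h
      rw [h] at h2
      simp at h2
      rcases h2 with h2 | h2
      · exact hI (by simp [h2])
      · exact hx0 h2
    rw [hrec x hx]
    congr 2
    apply mul_left_cancel₀ hζ
    simp only [hg_def]
    linear_combination h1 - v * h2

lemma isHolomorphicToQ_gaussDeriv (hε : IsOrientedImmersion ε n)
    (hn : IsHolomorphicToSphere n) {f : M → Q} (hf : ∀ x, (f x).base = n x)
    (hfop : ∀ x (t : TS (n x)) (s : TS (f x).base), (t : E3) = s →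
      (gaussDeriv ε n x t : E3) = (f x).op s) : IsHolomorphicToQ f := by
  have : IsManifold 𝓘(ℂ, ℂ) 1 M := IsManifold.of_le (n := ω) le_top
  intro x
  obtain ⟨κ, hκ, hx⟩ := exists_stereoDen_ne_zero (n x)
  set e := chartAt ℂ x with he_def
  have he : e ∈ atlas ℂ M := chart_mem_atlas ℂ x
  have hxs : x ∈ e.source := mem_chart_source ℂ x
  have hO := isOpen_normalSet κ hε.continuous_normal e
  have hxO : e x ∈ normalSet κ n e := ⟨e.map_source hxs, by rwa [e.left_inv hxs]⟩
  have hU : DifferentiableAt ℂ (coordU κ (f ∘ e.symm)) (e x) := by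
    have : coordU κ (f ∘ e.symm) = fun y => stereo κ (n (e.symm y)) := by
      ext y
      simp [coordU, hf]
    rw [this]
    exact differentiableAt_stereo_normal hn hκ he hxO.1 hxO.2
  have h1 := mdifferentiableAt_toAssoc (ψ := f ∘ e.symm) hκ (by
    filter_upwards [hO.mem_nhds hxO] with y hy
    rw [Function.comp_apply, hf]
    exact hy.2) hU (differentiableAt_coordZ_gaussDeriv hε hn hf hfop hκ he hxO)
  have h2 := h1.comp x (mdifferentiableAt_atlas (I := 𝓘(ℂ, ℂ)) he hxs)
  refine h2.congr_of_eventuallyEq ?_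
  filter_upwards [e.open_source.mem_nhds hxs] with y hy
  simp [e.left_inv hy]

end

end SecondOrderContact

end

theorem mainTheorem2 :
    (∀ (C : Type*) [TopologicalSpace C] [ChartedSpace ℂ C] [IsManifold 𝓘(ℝ, ℂ) ∞ C]
      (c : C → Q), IsImmersedSurface c → (OmegaClosedOn c ↔ IsComplexCurve c)) ∧
    (∀ (M : Type*) [TopologicalSpace M] [ChartedSpace ℂ M] [IsManifold 𝓘(ℂ, ℂ) ω M]
      (ε : M → E3) (n : M → S2), IsOrientedImmersion ε n → ∀ hmin : IsMinimal ε n,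
      IsHolomorphicToSphere n →
      ∃ hsymm : ∀ x, (gaussDeriv ε n x).IsSymmetric,
        IsHolomorphicToQ fun x => Q.mk (n x) (gaussDeriv ε n x) (hsymm x) (hmin x)) := by
  refine ⟨fun C _ _ _ c hc => ⟨isComplexCurve_of_omegaClosedOn hc,
    omegaClosedOn_of_isComplexCurve hc⟩, fun M _ _ _ ε n hε hmin hn =>
      ⟨gaussDeriv_isSymmetric hε hn, ?_⟩⟩
  refine isHolomorphicToQ_gaussDeriv hε hn (fun _ => rfl) fun x t s hts => ?_
  rw [Subtype.ext hts]
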